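/- Let $k=\mathbb F_q$ be a finite field, let $r\ge 2$ and let $X=(\mathbb P^1)^r$ over $k$, with homogeneous coordinates $[X_i:Z_i]$ on the $i$-th factor. Let $E_i=V(Z_i)$, let $m_1,\dots,m_r$ be integers with $0\le m_i<q-2$, put $G=\sum_{i=1}^r m_iE_i$, and let $\mathcal P=\{P_1,\dots,P_n\}$, $n=q^r$, be the set of all $k$-rational points of the affine chart $\bigcap_i\{Z_i\ne 0\}$. For a divisor $G'$ on $X$ (always defined over $k$) whose support is disjoint from $\mathcal P$, the functional code $C_L(\mathcal P,G')\subseteq k^n$ is the image of $L(G')=\{f\in k(X)^*: (f)+G'\ge 0\}\cup\{0\}$ under $f\mapsto (f(P_1),\dots,f(P_n))$. A strictly rectified differential code over $\mathcal P$ is defined as follows. Let $G'$ be as above, let $\mathcal D=\{D_1,\dots,D_r\}$ be properly intersecting effective divisors on $X$ with $\mathcal P\subseteq\bigcap_l D_l$ (set-theoretically). At each point $P\in\bigcap_l D_l$ let $f_1,\dots,f_r$ be local equations of $D_1,\dots,D_r$, let $x_1,\dots,x_r$ generate the maximal ideal of $\mathcal O_P$, let $a>0$ and $r_{ij}\in\mathcal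 O_P$ be such that $x_i^a=\sum_j r_{ij}f_j$ for all $i$, and put $R_P=\det[r_{ij}]$. A function $\theta\in k(X)^*$, regular at all points of $\bigcap_l D_l$, is strictly $(\mathcal D,\mathcal P)$-rectifying if $R_P\theta\equiv c_P\,x_1^{a-1}\cdots x_r^{a-1} \pmod{(x_1^a,\dots,x_r^a)}$ with $c_P\in k^*$ for $P\in\mathcal P$, and $R_P\theta\equiv 0\pmod{(x_1^a,\dots,x_r^a)}$ for the other points $P$ of $\bigcap_l D_l$. For such $\theta$ the code is the image in $k^n$ of $$\Omega^r\Big(\sum_l D_l-G'-(\theta)^+\Big)=\Big\{0\ne\omega\in\Omega^r(X):(\omega)+\sum_l D_l-G'-(\theta)^+\ge 0\Big\}\cup\{0\},$$ where $\Omega^r(X)$ is the space of rational $r$-differentials on $X$ over $k$ and $(\theta)^+$ is the divisor of zeros of $\theta$, under the map whose component at $P\in\mathcal P$ sends $\omega$ to the Grothendieck residue of $\omega$ relative to $D_1,\dots,D_r$, i.e. to the coefficient of $x_1^{a-1}\cdots x_r^{a-1}$ in the power series expansion of $R_P h$ in $x_1,\dots,x_r$, where $f_1\cdots f_r\,\omega=h\,dx_1\wedge\dots\wedge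 dx_r$. (Neither notion depends on the choices of $f_l$, $x_i$, $a$, $r_{ij}$.) Then the dual $C_L(\mathcal P,G)^\perp$ with respect to the standard dot product on $k^n$ is not a functional code: there is no divisor $G'$ on $X$ with support disjoint from $\mathcal P$ such that $C_L(\mathcal P,G)^\perp=C_L(\mathcal P,G')$. Likewise, $C_L(\mathcal P,G)^\perp$ is not a strictly rectified differential code over $\mathcal P$. -/

import Mathlib

open scoped Matrix

namespace RectifiedCodes

/-!
An integral separated scheme of finite type over a field `k` with function field `K` is described
here by the set `X` of its local rings `O_P ⊆ K`, where `P` runs through all scheme-theoretic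
points (by separatedness, a point is determined by its local ring). A point `P` lies in the closure
of a point `Y` if and only if `O_P ⊆ O_Y`. If `X` is smooth, its prime divisors are the points whose
local ring is a discrete valuation ring.
-/

section Variety

variable {K : Type*} [Field K]

/-- A prime divisor of the smooth variety with set of local rings `X`, given by its local ring. -/
structure PrimeDivisor (X : Set (LocalSubring K)) where
  /-- the local ring at the generic point of the prime divisor -/
  ring : ValuationSubring K
  isDVR : IsDiscreteValuationRing ring
  mem : ring.toLocalSubring ∈ X

attribute [instance] PrimeDivisor.isDVR

variable {X : Set (LocalSubring K)}

/-- The order of vanishing of `f ≠ 0` along `Y` (and `0` for `f = 0`). -/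
noncomputable def PrimeDivisor.ord (Y : PrimeDivisor X) (f : K) : ℤ :=
  WithZero.log (Ring.ordFrac Y.ring f)

/-- The point with local ring `P` lies on the prime divisor `Y`. -/
def PrimeDivisor.Through (Y : PrimeDivisor X) (P : LocalSubring K) : Prop :=
  P.toSubring ≤ Y.ring.toSubring

/-- Divisors on `X`: the finite formal integral combinations of prime divisors. -/
abbrev Divisor (X : Set (LocalSubring K)) := PrimeDivisor X →₀ ℤ

/-- The point `P` lies in the support of the divisor `G`. -/
def InSupport (G : Divisor X) (P : LocalSubring K) : Prop :=
  ∃ Y : PrimeDivisor X, G Y ≠ 0 ∧ Y.Through P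

/-- The Riemann-Roch space `L(W) = {f | (f) + W ≥ 0} ∪ {0}`. -/
def rrSpace (W : PrimeDivisor X → ℤ) : Set K :=
  {f | f = 0 ∨ ∀ Y : PrimeDivisor X, 0 ≤ Y.ord f + W Y}

/-- The points of `X` in the set-theoretic intersection of the supports of `D_1, …, D_r`. -/
def inter {r : ℕ} (D : Fin r → Divisor X) : Set (LocalSubring K) :=
  {P | P ∈ X ∧ ∀ l, InSupport (D l) P}

/-- The divisors `D_1, …, D_r` are effective and intersect properly: every point of the
intersection of their supports has codimension `r` in `X`. -/
def ProperlyIntersecting {r : ℕ} (D : Fin r → Divisor X) : Prop :=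
  (∀ l Y, 0 ≤ D l Y) ∧ ∀ P ∈ inter D, ringKrullDim P.toSubring = r

/-- The auxiliary choices at a point `P`: local equations `f_l` of the `D_l`, generators
`x_1, …, x_r` of the maximal ideal, an exponent `a > 0` and a matrix `[r_ij]` over `O_P` with
`x_i ^ a = ∑ j, r_ij f_j`. -/
structure LocalChoice {r : ℕ} (D : Fin r → Divisor X) (P : LocalSubring K) where
  f : Fin r → P.toSubring
  f_ne_zero : ∀ l, f l ≠ 0
  ord_f : ∀ l (Y : PrimeDivisor X), Y.Through P → Y.ord (f l : K) = D l Y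
  x : Fin r → P.toSubring
  span_x : Ideal.span (Set.range x) = IsLocalRing.maximalIdeal P.toSubring
  a : ℕ
  a_pos : 0 < a
  mat : Matrix (Fin r) (Fin r) P.toSubring
  x_pow : ∀ i, x i ^ a = ∑ j, mat i j * f j

/-- The ideal `(x_1 ^ a, …, x_r ^ a)` of `O_P`. -/
def LocalChoice.powIdeal {r : ℕ} {D : Fin r → Divisor X} {P : LocalSubring K}
    (F : LocalChoice D P) : Ideal P.toSubring :=
  Ideal.span (Set.range fun i => F.x i ^ F.a)

section OverField

variable (k : Type*) [Field k] [Algebra k K]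

/-- `f` is regular at `P` and its value at `P` is the scalar `c`. -/
def HasValue (P : LocalSubring K) (f : K) (c : k) : Prop :=
  ∃ z ∈ IsLocalRing.maximalIdeal P.toSubring, f - algebraMap k K c = (z : K)

/-- `dx_1 ∧ ⋯ ∧ dx_r` as a rational `r`-differential of `X` over `k`. -/
noncomputable def wedgeD {r : ℕ} (x : Fin r → K) : ⋀[K]^r (Ω[K⁄k]) :=
  exteriorPower.ιMulti K r fun i => KaehlerDifferential.D k K (x i)

/-- The rational `r`-differentials that are regular at the point with local ring `A`. -/
noncomputable def regularForms (r : ℕ) (A : Subring K) : Submodule A (⋀[K]^r (Ω[K⁄k])) :=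
  Submodule.span A (Set.range fun b : Fin r → A => wedgeD k fun i => (b i : K))

/-- The space `Ω^r(W) = {ω | (ω) + W ≥ 0} ∪ {0}`: for every prime divisor `Y`, the product of `ω`
with a rational function of order `W Y` along `Y` is regular at the generic point of `Y`. -/
def formSpace (r : ℕ) (W : PrimeDivisor X → ℤ) : Set (⋀[K]^r (Ω[K⁄k])) :=
  {ω | ∀ Y : PrimeDivisor X, ∃ g : K, g ≠ 0 ∧ Y.ord g = W Y ∧
    g • ω ∈ regularForms k r Y.ring.toSubring}

/-- `S` is the power series expansion of `h ∈ O_P` in the generators `x_1, …, x_r` of the maximal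
ideal: for every `n`, `h` agrees modulo the `n`-th power of the maximal ideal with the value at `x`
of any polynomial that has the same coefficients as `S` in degrees less than `n`. -/
def HasExpansion {r : ℕ} {P : LocalSubring K} (x : Fin r → P.toSubring) (h : P.toSubring)
    (S : MvPowerSeries (Fin r) k) : Prop :=
  ∀ (n : ℕ) (p : MvPolynomial (Fin r) k),
    (∀ I : Fin r →₀ ℕ, I.degree < n → p.coeff I = MvPowerSeries.coeff I S) →
    ∃ z ∈ IsLocalRing.maximalIdeal P.toSubring ^ n,
      (h : K) - MvPolynomial.aeval (fun i => (x i : K)) p = (z : K)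

/-- The Grothendieck residue of `ω` at the `k`-rational point `P` relative to `D_1, …, D_r` is `c`:
if `f_1 ⋯ f_r ω = h dx_1 ∧ ⋯ ∧ dx_r` with `h ∈ O_P`, then `c` is the coefficient of
`(x_1 ⋯ x_r) ^ (a - 1)` in the expansion of `det [r_ij] h`. -/
def HasResidue {r : ℕ} {D : Fin r → Divisor X} {P : LocalSubring K} (F : LocalChoice D P)
    (ω : ⋀[K]^r (Ω[K⁄k])) (c : k) : Prop :=
  ∃ h : P.toSubring,
    (∏ l, (F.f l : K)) • ω = (h : K) • wedgeD k (fun i => (F.x i : K)) ∧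
    ∃ S : MvPowerSeries (Fin r) k, HasExpansion k F.x (F.mat.det * h) S ∧
      MvPowerSeries.coeff (Finsupp.equivFunOnFinite.symm fun _ => F.a - 1) S = c

variable {ι : Type*} [Fintype ι]

/-- The functional code `C_L(𝒫, G)`, where `𝒫` is the family `pts` of rational points. -/
def functionalCode (pts : ι → LocalSubring K) (G : Divisor X) : Set (ι → k) :=
  {v | ∃ f ∈ rrSpace (G : PrimeDivisor X → ℤ), ∀ i, HasValue k (pts i) f (v i)}

/-- `C` is a functional code on `X` over the points `pts`. -/
def IsFunctionalCode (X : Set (LocalSubring K)) (pts : ι → LocalSubring K)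
    (C : Set (ι → k)) : Prop :=
  ∃ G : Divisor X, (∀ i, ¬ InSupport G (pts i)) ∧ C = functionalCode k pts G

/-- `θ` is strictly `(𝒟, 𝒫)`-rectifying. -/
def StrictlyRectifying {r : ℕ} (pts : ι → LocalSubring K) {D : Fin r → Divisor X}
    (F : ∀ P : inter D, LocalChoice D P.1) (θ : K) : Prop :=
  θ ≠ 0 ∧ (∀ P : inter D, θ ∈ P.1.toSubring) ∧
  (∀ P : inter D, P.1 ∈ Set.range pts → ∃ c : k, c ≠ 0 ∧ ∃ z ∈ (F P).powIdeal,
    ((F P).mat.det : K) * θ - algebraMap k K c * ∏ j, ((F P).x j : K) ^ ((F P).a - 1) = (z : K)) ∧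
  (∀ P : inter D, P.1 ∉ Set.range pts → ∃ z ∈ (F P).powIdeal,
    ((F P).mat.det : K) * θ = (z : K))

/-- The differential code `C_Ω(𝒟, 𝒫, θ, G)`: the image under the residues at the points of `𝒫` of
`Ω^r(∑ D_l - G - (θ)⁺)`. -/
def differentialCode {r : ℕ} (pts : ι → LocalSubring K) {D : Fin r → Divisor X}
    (hpts : ∀ i, pts i ∈ inter D) (F : ∀ P : inter D, LocalChoice D P.1) (θ : K)
    (G : Divisor X) : Set (ι → k) :=
  {v | ∃ ω ∈ formSpace (X := X) k r (fun Y => ∑ l, D l Y - G Y - max (Y.ord θ) 0),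
    ∀ i, HasResidue k (F ⟨pts i, hpts i⟩) ω (v i)}

/-- `C` is a strictly rectified differential code on the `r`-dimensional variety `X` over the points
`pts`. Neither the rectifying condition nor the residues depend on the auxiliary choices `F`. -/
def IsStrictlyRectifiedCode (r : ℕ) (X : Set (LocalSubring K)) (pts : ι → LocalSubring K)
    (C : Set (ι → k)) : Prop :=
  ∃ (G : Divisor X) (D : Fin r → Divisor X) (hpts : ∀ i, pts i ∈ inter D)
    (F : ∀ P : inter D, LocalChoice D P.1) (θ : K),
    (∀ i, ¬ InSupport G (pts i)) ∧ ProperlyIntersecting D ∧ StrictlyRectifying k pts F θ ∧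
    C = differentialCode k pts hpts F θ G

variable {k}

/-- The dual of a code with respect to the standard dot product. -/
def dualCode (C : Set (ι → k)) : Set (ι → k) :=
  {v | ∀ c ∈ C, c ⬝ᵥ v = 0}

end OverField

end Variety

section ProductOfLines

/-- The localization of a Noetherian domain at a nonzero principal prime is a discrete valuation
ring. -/
theorem isDVR_ofPrime {K : Type*} [Field K] (A : Subring K) [IsNoetherianRing A] (p : Ideal A)
    [p.IsPrime] (y : A) (hy : y ≠ 0) (hp : p = Ideal.span {y}) :
    IsDiscreteValuationRing (LocalSubring.ofPrime A p).toSubring := by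
  have hO : IsNoetherianRing (LocalSubring.ofPrime A p).toSubring :=
    IsLocalization.isNoetherianRing p.primeCompl _ inferInstance
  have hm : IsLocalRing.maximalIdeal (LocalSubring.ofPrime A p).toSubring =
      Ideal.span {algebraMap A (LocalSubring.ofPrime A p).toSubring y} := by
    rw [← IsLocalization.AtPrime.map_eq_maximalIdeal p, ← Set.image_singleton, ← Ideal.map_span]
    exact congrArg _ hp
  have hne : algebraMap A (LocalSubring.ofPrime A p).toSubring y ≠ 0 := fun h =>
    hy (Subtype.ext (congrArg
      (Subtype.val : (LocalSubring.ofPrime A p).toSubring → K) h))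
  have hf : ¬ IsField (LocalSubring.ofPrime A p).toSubring := by
    rw [IsLocalRing.isField_iff_maximalIdeal_eq, hm, Ideal.span_singleton_eq_bot]
    exact hne
  refine ((IsDiscreteValuationRing.TFAE _ hf).out 0 4).2 ?_
  rw [hm]
  exact ⟨⟨_, rfl⟩⟩

variable (k : Type*) [Field k] (r : ℕ)

/-- The function field `k(x_1, …, x_r)` of `(ℙ¹)^r`, with `x_i = X_i / Z_i`. -/
abbrev FunField := FractionRing (MvPolynomial (Fin r) k)

variable {r}

/-- The coordinate `x_i = X_i / Z_i`. -/
noncomputable def coord (i : Fin r) : FunField k r :=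
  algebraMap (MvPolynomial (Fin r) k) (FunField k r) (MvPolynomial.X i)

/-- The coordinates of the standard affine chart of `(ℙ¹)^r` indexed by `s`: `Z_i / X_i` if `s i`
is true and `X_i / Z_i` otherwise. -/
noncomputable def chartCoord (s : Fin r → Bool) (i : Fin r) : FunField k r :=
  if s i then (coord k i)⁻¹ else coord k i

/-- The coordinate ring of the chart indexed by `s`. -/
noncomputable def chart (s : Fin r → Bool) : Subalgebra k (FunField k r) :=
  Algebra.adjoin k (Set.range (chartCoord k s))

variable (r)

/-- `(ℙ¹)^r` over `k`: the local rings at all prime ideals of its `2 ^ r` standard affine charts. -/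
def P1Pow : Set (LocalSubring (FunField k r)) :=
  {P | ∃ (s : Fin r → Bool) (p : PrimeSpectrum (chart k s).toSubring),
    P = LocalSubring.ofPrime (chart k s).toSubring p.asIdeal}

variable {r}

theorem algebraicIndependent_chartCoord (s : Fin r → Bool) :
    AlgebraicIndependent k (chartCoord k s) := by
  have hx : AlgebraicIndependent k (coord k : Fin r → FunField k r) := by
    have h := (MvPolynomial.algebraicIndependent_X (Fin r) k).map'
      (f := IsScalarTower.toAlgHom k (MvPolynomial (Fin r) k) (FunField k r))
      (IsFractionRing.injective _ _)
    exact h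
  set A := Algebra.adjoin k (Set.range (chartCoord k s))
  have hc : ∀ i, IsAlgebraic A (coord k i : FunField k r) := by
    intro i
    have h1 : IsAlgebraic A (chartCoord k s i) :=
      isAlgebraic_algebraMap (⟨_, Algebra.subset_adjoin ⟨i, rfl⟩⟩ : A)
    unfold chartCoord at h1
    split_ifs at h1
    · simpa using h1.inv
    · exact h1
  have hp : ∀ p : MvPolynomial (Fin r) k,
      IsAlgebraic A (algebraMap _ (FunField k r) p) := by
    intro p
    induction p using MvPolynomial.induction_on with
    | C c => exact isAlgebraic_algebraMap (algebraMap k A c)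
    | add p q hp hq => rw [map_add]; exact hp.add hq
    | mul_X p i hp => rw [map_mul]; exact hp.mul (hc i)
  have : Algebra.IsAlgebraic A (FunField k r) := by
    refine ⟨fun z => ?_⟩
    obtain ⟨p, q, -, rfl⟩ := IsFractionRing.div_surjective (A := MvPolynomial (Fin r) k) z
    rw [div_eq_mul_inv]
    exact (hp p).mul (hp q).inv
  refine (Algebra.IsAlgebraic.isTranscendenceBasis_of_lift_le_trdeg_of_finite k _ ?_).1
  exact hx.lift_cardinalMk_le_trdeg

/-- Each chart is an affine space. -/
noncomputable def chartEquiv (s : Fin r → Bool) :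
    MvPolynomial (Fin r) k ≃ₐ[k] chart k s :=
  (algebraicIndependent_chartCoord k s).aevalEquiv

/-- The prime ideal of the chart `s` corresponding to the prime `p` of the polynomial ring. -/
noncomputable def chartPrime (s : Fin r → Bool) (p : PrimeSpectrum (MvPolynomial (Fin r) k)) :
    PrimeSpectrum (chart k s).toSubring :=
  PrimeSpectrum.comap ((chartEquiv k s).symm.toRingEquiv : (chart k s) →+* _) p

/-- The rational point `(α_1, …, α_r)` of the affine chart on which all `Z_i` are nonzero. -/
noncomputable def affinePoint (α : Fin r → k) : LocalSubring (FunField k r) :=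
  LocalSubring.ofPrime (chart k fun _ => false).toSubring
    (chartPrime k (fun _ => false)
      ⟨RingHom.ker (MvPolynomial.eval α), RingHom.ker_isPrime _⟩).asIdeal

/-- The chart on which only `X_i / Z_i` is replaced by `Z_i / X_i`. -/
def invChart (i : Fin r) : Fin r → Bool := fun j => decide (j = i)

/-- The prime ideal of `E_i = V(Z_i)` in the chart `invChart i`: it is generated by `Z_i / X_i`. -/
noncomputable def polarPrime (i : Fin r) : PrimeSpectrum (chart k (invChart i)).toSubring :=
  chartPrime k (invChart i)
    ⟨Ideal.span {MvPolynomial.X i},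
      (Ideal.span_singleton_prime (MvPolynomial.X_ne_zero i)).2 MvPolynomial.X_prime⟩

theorem polar_aux (i : Fin r) :
    IsNoetherianRing (chart k (invChart i)).toSubring ∧
    ∃ y : (chart k (invChart i)).toSubring, y ≠ 0 ∧
      (polarPrime k i).asIdeal = Ideal.span {y} := by
  let e : MvPolynomial (Fin r) k ≃+* (chart k (invChart i)).toSubring :=
    (chartEquiv k (invChart i)).toRingEquiv
  refine ⟨isNoetherianRing_of_ringEquiv _ e, e (MvPolynomial.X i), ?_, ?_⟩
  · simp
  · have h1 : (polarPrime k i).asIdeal =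
        (Ideal.span {(MvPolynomial.X i : MvPolynomial (Fin r) k)}).comap e.symm := rfl
    rw [h1, Ideal.comap_symm, Ideal.map_span, Set.image_singleton]

theorem polar_isDVR (i : Fin r) :
    IsDiscreteValuationRing
      (LocalSubring.ofPrime (chart k (invChart i)).toSubring
        (polarPrime k i).asIdeal).toSubring := by
  obtain ⟨hA, y, hy, hp⟩ := polar_aux k i
  exact isDVR_ofPrime _ _ y hy hp

theorem polar_mem_or_inv_mem (i : Fin r) (z : FunField k r) :
    z ∈ (LocalSubring.ofPrime (chart k (invChart i)).toSubring (polarPrime k i).asIdeal).toSubring ∨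
    z⁻¹ ∈ (LocalSubring.ofPrime (chart k (invChart i)).toSubring
      (polarPrime k i).asIdeal).toSubring := by
  set O := (LocalSubring.ofPrime (chart k (invChart i)).toSubring
    (polarPrime k i).asIdeal).toSubring
  have hdvr : IsDiscreteValuationRing O := polar_isDVR k i
  have hO : ∀ w : FunField k r, ∃ a b : O, b ≠ 0 ∧ w = (a : FunField k r) / (b : FunField k r) := by
    have hle : ∀ u ∈ chart k (invChart i), u ∈ O := fun u hu => LocalSubring.le_ofPrime _ _ hu
    have hc : ∀ j, ∃ a b : O, b ≠ 0 ∧ coord k j = (a : FunField k r) / (b : FunField k r) := by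
      intro j
      have h1 : chartCoord k (invChart i) j ∈ O := hle _ (Algebra.subset_adjoin ⟨j, rfl⟩)
      have h0 : coord k j ≠ 0 := by
        unfold coord
        simp
      unfold chartCoord at h1
      split_ifs at h1
      · exact ⟨1, ⟨_, h1⟩, by simpa [Subtype.ext_iff] using h0, by simp⟩
      · exact ⟨⟨_, h1⟩, 1, one_ne_zero, by simp⟩
    have hp : ∀ p : MvPolynomial (Fin r) k, ∃ a b : O, b ≠ 0 ∧
        algebraMap _ (FunField k r) p = (a : FunField k r) / (b : FunField k r) := by
      intro p
      induction p using MvPolynomial.induction_on with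
      | C c => exact ⟨⟨_, hle _ (algebraMap_mem _ c)⟩, 1, one_ne_zero, by simp; rfl⟩
      | add p q hp hq =>
        obtain ⟨a, b, hb, h⟩ := hp
        obtain ⟨a', b', hb', h'⟩ := hq
        refine ⟨a * b' + b * a', b * b', mul_ne_zero hb hb', ?_⟩
        rw [map_add, h, h', div_add_div _ _ (by simpa using hb) (by simpa using hb')]
        simp
      | mul_X p j hp =>
        obtain ⟨a, b, hb, h⟩ := hp
        obtain ⟨a', b', hb', h'⟩ := hc j
        refine ⟨a * a', b * b', mul_ne_zero hb hb', ?_⟩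
        rw [map_mul, h]
        change _ * coord k j = _
        rw [h', div_mul_div_comm]
        simp
    intro w
    obtain ⟨p, q, hq, rfl⟩ := IsFractionRing.div_surjective (A := MvPolynomial (Fin r) k) w
    obtain ⟨a, b, hb, h⟩ := hp p
    obtain ⟨a', b', hb', h'⟩ := hp q
    have hq0 : algebraMap _ (FunField k r) q ≠ 0 :=
      IsFractionRing.to_map_ne_zero_of_mem_nonZeroDivisors hq
    have ha' : a' ≠ 0 := by
      rintro rfl
      exact hq0 (by rw [h']; simp)
    refine ⟨a * b', b * a', mul_ne_zero hb ha', ?_⟩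
    rw [h, h', div_div_div_eq]
    simp
  obtain ⟨a, b, hb, rfl⟩ := hO z
  have hb0 : (b : FunField k r) ≠ 0 := by simpa using hb
  rcases ValuationRing.dvd_total a b with ⟨c, rfl⟩ | ⟨c, rfl⟩
  · right
    have ha0 : (a : FunField k r) ≠ 0 := by
      rintro h
      exact hb0 (by simp [h])
    have : ((a : FunField k r) / ((a * c : O) : FunField k r))⁻¹ = c := by
      rw [inv_div, Subring.coe_mul, mul_div_cancel_left₀ _ ha0]
    rw [this]
    exact c.2
  · left
    have : ((b * c : O) : FunField k r) / (b : FunField k r) = c := by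
      rw [Subring.coe_mul, mul_div_cancel_left₀ _ hb0]
    rw [this]
    exact c.2

/-- The prime divisor `E_i = V(Z_i)` of `(ℙ¹)^r`. -/
noncomputable def polarDivisor (i : Fin r) : PrimeDivisor (P1Pow k r) where
  ring :=
    { (LocalSubring.ofPrime (chart k (invChart i)).toSubring (polarPrime k i).asIdeal).toSubring with
      mem_or_inv_mem' := polar_mem_or_inv_mem k i }
  isDVR := polar_isDVR k i
  mem := ⟨invChart i, polarPrime k i, rfl⟩

end ProductOfLines

end RectifiedCodes

/-!
Divisors on `(ℙ¹)^r` become principal on the affine chart, because polynomial rings are factorial.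
So `L(G')` consists of the quotients `p / H`, with `H` fixed and `p` running through the
polynomials whose degree in each variable is bounded, and if the support of `G'` avoids `𝒫` then
`H` has nonzero values on `𝒫`: the functional code is the code of the words `w α * p(α)` with all
`w α ≠ 0`. Strictly rectified differential codes have the same shape: the differentials in
question are `(p / H) dx_1 ∧ ⋯ ∧ dx_r`, and since `R_P θ` is congruent to a nonzero multiple of
the socle generator `(x_1 ⋯ x_r) ^ (a - 1)`, the residue at `P` is a nonzero multiple of the value
of `p`.

No code of this shape is dual to `C_L(𝒫, G)`. If all degree bounds are at least `q - 1`, it is the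
whole space, whereas the all-ones word lies in `C_L(𝒫, G)`. If the bound in the variable `l` is
smaller than `q - 1`, then `p` sums to zero along every line parallel to the `l`-th axis; but the
indicator of the hyperplane `x_l = 0` is orthogonal to `C_L(𝒫, G)`, as one sees by summing along
another axis, while it meets such a line in one point.
-/

namespace RectifiedCodes

section LocalRings

variable {K : Type*} [Field K]

/-- `x` is regular at the point with local ring `P` and vanishes there. -/
def Vanishes (P : LocalSubring K) (x : K) : Prop :=
  ∃ z ∈ IsLocalRing.maximalIdeal P.toSubring, x = (z : K)

section

variable {P : LocalSubring K} {x y : K}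

theorem vanishes_coe {z : P.toSubring} :
    Vanishes P (z : K) ↔ z ∈ IsLocalRing.maximalIdeal P.toSubring := by
  constructor
  · rintro ⟨w, hw, h⟩
    rwa [Subtype.ext h]
  · exact fun h => ⟨z, h, rfl⟩

theorem Vanishes.mem (h : Vanishes P x) : x ∈ P.toSubring := by
  obtain ⟨z, -, rfl⟩ := h
  exact z.2

theorem Vanishes.add (hx : Vanishes P x) (hy : Vanishes P y) : Vanishes P (x + y) := by
  obtain ⟨z, hz, rfl⟩ := hx
  obtain ⟨w, hw, rfl⟩ := hy
  exact ⟨z + w, add_mem hz hw, rfl⟩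

theorem Vanishes.sub (hx : Vanishes P x) (hy : Vanishes P y) : Vanishes P (x - y) := by
  obtain ⟨z, hz, rfl⟩ := hx
  obtain ⟨w, hw, rfl⟩ := hy
  exact ⟨z - w, sub_mem hz hw, rfl⟩

theorem Vanishes.mul_left (hx : x ∈ P.toSubring) (hy : Vanishes P y) : Vanishes P (x * y) := by
  obtain ⟨z, hz, rfl⟩ := hy
  exact ⟨⟨x, hx⟩ * z, Ideal.mul_mem_left _ _ hz, rfl⟩

theorem Vanishes.mul_right (hx : Vanishes P x) (hy : y ∈ P.toSubring) : Vanishes P (x * y) :=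
  mul_comm x y ▸ hx.mul_left hy

theorem not_vanishes_one (P : LocalSubring K) : ¬ Vanishes P 1 := by
  rintro ⟨z, hz, h⟩
  obtain rfl : z = 1 := Subtype.ext h.symm
  exact (Ideal.ne_top_iff_one _).1 (IsLocalRing.maximalIdeal.isMaximal _).ne_top hz

theorem not_vanishes_of_inv_mem (hx : x ≠ 0) (h : x⁻¹ ∈ P.toSubring) : ¬ Vanishes P x := fun hv =>
  not_vanishes_one P (by simpa [hx] using hv.mul_left h)

theorem ne_zero_of_not_vanishes (h : ¬ Vanishes P x) : x ≠ 0 := by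
  rintro rfl
  exact h ⟨0, zero_mem _, rfl⟩

theorem inv_mem_of_not_vanishes (hx : x ∈ P.toSubring) (h : ¬ Vanishes P x) :
    x⁻¹ ∈ P.toSubring := by
  have hu : IsUnit (⟨x, hx⟩ : P.toSubring) := by
    by_contra hu
    exact h ⟨⟨x, hx⟩, (IsLocalRing.mem_maximalIdeal _).2 hu, rfl⟩
  obtain ⟨y, hy⟩ := hu.exists_right_inv
  have hxy : x * (y : K) = 1 := congrArg Subtype.val hy
  exact eq_inv_of_mul_eq_one_right hxy ▸ y.2

end

theorem vanishes_inv_of_notMem (P : ValuationSubring K) {x : K} (hx : x ∉ P) :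
    Vanishes P.toLocalSubring x⁻¹ := by
  have hmem : x⁻¹ ∈ P.toLocalSubring.toSubring := (P.mem_or_inv_mem x).resolve_left hx
  by_contra hv
  exact hx (inv_inv x ▸ inv_mem_of_not_vanishes hmem hv)

theorem mem_ofPrime_iff (A : Subring K) (p : Ideal A) [p.IsPrime] (x : K) :
    x ∈ (LocalSubring.ofPrime A p).toSubring ↔ ∃ a b : A, b ∉ p ∧ x = (a : K) / (b : K) := by
  constructor
  · intro hx
    obtain ⟨⟨a, b⟩, h⟩ := IsLocalization.surj p.primeCompl
      (⟨x, hx⟩ : (LocalSubring.ofPrime A p).toSubring)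
    have hb : ((b : A) : K) ≠ 0 := by
      simpa using fun h0 : (b : A) = 0 => b.2 (h0 ▸ zero_mem p)
    exact ⟨a, b, b.2, (eq_div_iff hb).2 (congrArg Subtype.val h)⟩
  · rintro ⟨a, b, hb, rfl⟩
    have hu := IsLocalization.map_units (LocalSubring.ofPrime A p).toSubring
      (⟨b, hb⟩ : p.primeCompl)
    obtain ⟨c, hc⟩ := hu.exists_right_inv
    have hbc : (b : K) * (c : K) = 1 := congrArg Subtype.val hc
    rw [div_eq_mul_inv, ← eq_inv_of_mul_eq_one_right hbc]
    exact mul_mem (LocalSubring.le_ofPrime A p a.2) c.2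

theorem vanishes_ofPrime_iff (A : Subring K) (p : Ideal A) [p.IsPrime] (a : A) :
    Vanishes (LocalSubring.ofPrime A p) (a : K) ↔ a ∈ p := by
  rw [← IsLocalization.AtPrime.to_map_mem_maximal_iff (LocalSubring.ofPrime A p).toSubring p a,
    ← vanishes_coe]
  rfl

/-- The center on `B` of a local ring `P` containing `B`: the prime ideal of the image in `Spec B`
of the closed point of `Spec P`. -/
def centerIdeal (B : Subring K) (P : LocalSubring K) (h : B ≤ P.toSubring) : Ideal B :=
  (IsLocalRing.maximalIdeal P.toSubring).comap (Subring.inclusion h)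

instance (B : Subring K) (P : LocalSubring K) (h : B ≤ P.toSubring) :
    (centerIdeal B P h).IsPrime := Ideal.comap_isPrime _ _

theorem mem_centerIdeal {B : Subring K} {P : LocalSubring K} {h : B ≤ P.toSubring} {b : B} :
    b ∈ centerIdeal B P h ↔ Vanishes P (b : K) :=
  (vanishes_coe (z := Subring.inclusion h b)).symm

theorem ofPrime_centerIdeal_le (B : Subring K) (P : LocalSubring K) (h : B ≤ P.toSubring) :
    (LocalSubring.ofPrime B (centerIdeal B P h)).toSubring ≤ P.toSubring := by
  intro x hx
  obtain ⟨a, b, hb, rfl⟩ := (mem_ofPrime_iff _ _ _).1 hx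
  rw [mem_centerIdeal] at hb
  rw [div_eq_mul_inv]
  exact mul_mem (h a.2) (inv_mem_of_not_vanishes (h b.2) hb)

theorem ofPrime_eq_ofPrime_centerIdeal (A B : Subring K) (p : Ideal A) [p.IsPrime]
    (h : B ≤ (LocalSubring.ofPrime A p).toSubring)
    (hA : A ≤ (LocalSubring.ofPrime B (centerIdeal B (LocalSubring.ofPrime A p) h)).toSubring) :
    LocalSubring.ofPrime A p =
      LocalSubring.ofPrime B (centerIdeal B (LocalSubring.ofPrime A p) h) := by
  refine LocalSubring.toSubring_injective (le_antisymm (fun x hx => ?_)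
    (ofPrime_centerIdeal_le B _ h))
  obtain ⟨a, b, hb, rfl⟩ := (mem_ofPrime_iff _ _ _).1 hx
  rw [div_eq_mul_inv]
  refine mul_mem (hA a.2) ?_
  obtain ⟨c, d, hd, hcd⟩ := (mem_ofPrime_iff _ _ _).1 (hA b.2)
  rw [mem_centerIdeal] at hd
  have hc : c ∉ centerIdeal B (LocalSubring.ofPrime A p) h := by
    rw [mem_centerIdeal]
    intro hc
    rw [← vanishes_ofPrime_iff, hcd, div_eq_mul_inv] at hb
    exact hb (hc.mul_right (inv_mem_of_not_vanishes (h d.2) hd))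
  exact (mem_ofPrime_iff _ _ _).2 ⟨d, c, hc, by rw [hcd, inv_div]⟩

end LocalRings

namespace PrimeDivisor

variable {K : Type*} [Field K] {X : Set (LocalSubring K)}

theorem eq_of_toLocalSubring_eq {Y Z : PrimeDivisor X}
    (h : Y.ring.toLocalSubring = Z.ring.toLocalSubring) : Y = Z := by
  have hring : Y.ring = Z.ring :=
    ValuationSubring.toSubring_injective (congrArg LocalSubring.toSubring h)
  cases Y; cases Z; cases hring; rfl

variable (Y : PrimeDivisor X)

theorem mem_ring_iff_of_eq {P : LocalSubring K} (h : Y.ring.toLocalSubring = P) {f : K} :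
    f ∈ Y.ring ↔ f ∈ P.toSubring := h ▸ Iff.rfl

theorem ordFrac_ne_zero {f : K} (hf : f ≠ 0) : Ring.ordFrac Y.ring f ≠ 0 :=
  (map_ne_zero _).2 hf

theorem ord_mul {f g : K} (hf : f ≠ 0) (hg : g ≠ 0) : Y.ord (f * g) = Y.ord f + Y.ord g := by
  rw [ord, map_mul, WithZero.log_mul (Y.ordFrac_ne_zero hf) (Y.ordFrac_ne_zero hg), ord, ord]

@[simp]
theorem ord_zero : Y.ord 0 = 0 := by
  simp [ord]

@[simp]
theorem ord_one : Y.ord 1 = 0 := by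
  simp [ord]

@[simp]
theorem ord_inv (f : K) : Y.ord f⁻¹ = - Y.ord f := by
  simp [ord]

@[simp]
theorem ord_zpow (f : K) (n : ℤ) : Y.ord (f ^ n) = n * Y.ord f := by
  simp [ord]

@[simp]
theorem ord_pow (f : K) (n : ℕ) : Y.ord (f ^ n) = n * Y.ord f := by
  simp [ord]

theorem ord_div {f g : K} (hf : f ≠ 0) (hg : g ≠ 0) : Y.ord (f / g) = Y.ord f - Y.ord g := by
  rw [div_eq_mul_inv, Y.ord_mul hf (inv_ne_zero hg), Y.ord_inv, sub_eq_add_neg]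

theorem ord_prod {ι : Type*} (s : Finset ι) (f : ι → K) (hf : ∀ i ∈ s, f i ≠ 0) :
    Y.ord (∏ i ∈ s, f i) = ∑ i ∈ s, Y.ord (f i) := by
  classical
  induction s using Finset.induction_on with
  | empty => simp
  | insert a s ha ih =>
    simp only [Finset.forall_mem_insert] at hf
    rw [Finset.prod_insert ha, Finset.sum_insert ha,
      Y.ord_mul hf.1 (Finset.prod_ne_zero_iff.2 hf.2), ih hf.2]

theorem ord_nonneg_of_mem {f : K} (hf : f ∈ Y.ring) : 0 ≤ Y.ord f := by
  rcases eq_or_ne f 0 with rfl | hf0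
  · simp
  have hle : (1 : WithZero (Multiplicative ℤ)) ≤ Ring.ordFrac Y.ring f :=
    Ring.ordFrac_ge_one_of_ne_zero (R := Y.ring) (K := K) (x := ⟨f, hf⟩)
      fun h => hf0 (congrArg Subtype.val h)
  simpa [ord] using (WithZero.log_le_log one_ne_zero (Y.ordFrac_ne_zero hf0)).2 hle

theorem exists_uniformizer : ∃ ϖ : K, ϖ ≠ 0 ∧ Y.ord ϖ = 1 ∧
    Vanishes Y.ring.toLocalSubring ϖ ∧
    ∀ f, Vanishes Y.ring.toLocalSubring f → f / ϖ ∈ Y.ring := by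
  obtain ⟨ϖ, hϖ⟩ := IsDiscreteValuationRing.exists_irreducible Y.ring
  have hϖ0 : (ϖ : K) ≠ 0 := fun h => hϖ.ne_zero (Subtype.ext h)
  have hord : Ring.ordFrac Y.ring (ϖ : K) = WithZero.exp 1 :=
    Ring.ordFrac_irreducible (R := Y.ring) (K := K) hϖ
  refine ⟨ϖ, hϖ0, by simp [ord, hord],
    ⟨ϖ, (IsLocalRing.mem_maximalIdeal _).2 hϖ.not_isUnit, rfl⟩, ?_⟩
  rintro _ ⟨z, hz, rfl⟩
  have hm := (IsDiscreteValuationRing.irreducible_iff_uniformizer _).1 hϖ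
  obtain ⟨c, rfl⟩ : ϖ ∣ z := Ideal.mem_span_singleton.1 (hm.le hz)
  change (ϖ : K) * (c : K) / ϖ ∈ Y.ring
  rw [mul_div_cancel_left₀ _ hϖ0]
  exact c.2

theorem ord_pos_of_vanishes {f : K} (hf : f ≠ 0) (h : Vanishes Y.ring.toLocalSubring f) :
    0 < Y.ord f := by
  obtain ⟨ϖ, hϖ0, hord, -, hdiv⟩ := Y.exists_uniformizer
  have hnonneg := Y.ord_nonneg_of_mem (hdiv f h)
  rw [Y.ord_div hf hϖ0] at hnonneg
  omega

theorem ord_eq_one {z : K} (hz0 : z ≠ 0) (hz : Vanishes Y.ring.toLocalSubring z)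
    (h : ∀ f : K, Vanishes Y.ring.toLocalSubring f → f / z ∈ Y.ring) : Y.ord z = 1 := by
  obtain ⟨ϖ, hϖ0, hord, hϖ, -⟩ := Y.exists_uniformizer
  have hnonneg := Y.ord_nonneg_of_mem (h ϖ hϖ)
  rw [Y.ord_div hϖ0 hz0] at hnonneg
  have := Y.ord_pos_of_vanishes hz0 hz
  omega

theorem exists_ord_eq (n : ℤ) : ∃ g : K, g ≠ 0 ∧ Y.ord g = n := by
  obtain ⟨ϖ, hϖ0, hord, -⟩ := Y.exists_uniformizer
  exact ⟨ϖ ^ n, zpow_ne_zero _ hϖ0, by rw [Y.ord_zpow, hord, mul_one]⟩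

theorem mem_ring_iff {f : K} (hf : f ≠ 0) : f ∈ Y.ring ↔ 0 ≤ Y.ord f := by
  refine ⟨Y.ord_nonneg_of_mem, fun h => ?_⟩
  by_contra hmem
  have := Y.ord_pos_of_vanishes (inv_ne_zero hf) (vanishes_inv_of_notMem _ hmem)
  rw [Y.ord_inv] at this
  omega

theorem ord_eq_zero_of_not_vanishes {f : K} (hf : f ∈ Y.ring)
    (h : ¬ Vanishes Y.ring.toLocalSubring f) : Y.ord f = 0 := by
  have hinv := Y.ord_nonneg_of_mem
    (inv_mem_of_not_vanishes (P := Y.ring.toLocalSubring) hf h)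
  have := Y.ord_nonneg_of_mem hf
  rw [Y.ord_inv] at hinv
  omega

theorem exists_pow_div_mem_ring {f g : K} (hf : f ≠ 0) (hg : g ≠ 0)
    (h : Vanishes Y.ring.toLocalSubring f) : ∃ n : ℕ, f ^ n / g ∈ Y.ring := by
  refine ⟨(Y.ord g).toNat, ?_⟩
  rw [Y.mem_ring_iff (div_ne_zero (pow_ne_zero _ hf) hg), Y.ord_div (pow_ne_zero _ hf) hg,
    Y.ord_pow]
  nlinarith [Y.ord_pos_of_vanishes hf h, (Y.ord g).self_le_toNat]

end PrimeDivisor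

section Charts

variable (k : Type*) [Field k] {r : ℕ}

theorem coord_ne_zero (i : Fin r) : coord k i ≠ 0 := by
  simp [coord]

theorem chartCoord_ne_zero (s : Fin r → Bool) (i : Fin r) : chartCoord k s i ≠ 0 := by
  unfold chartCoord
  split_ifs
  · exact inv_ne_zero (coord_ne_zero k i)
  · exact coord_ne_zero k i

theorem chartCoord_eq_or_eq_inv (s t : Fin r → Bool) (i : Fin r) :
    chartCoord k t i = chartCoord k s i ∨ chartCoord k t i = (chartCoord k s i)⁻¹ := by
  unfold chartCoord
  split_ifs <;> simp

theorem chartCoord_invChart_self (i : Fin r) : chartCoord k (invChart i) i = (coord k i)⁻¹ := by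
  simp [chartCoord, invChart]

theorem chartCoord_invChart_of_ne {i j : Fin r} (h : j ≠ i) :
    chartCoord k (invChart i) j = coord k j := by
  simp [chartCoord, invChart, h]

/-- The embedding of the coordinate ring of the chart `s` into the function field. -/
noncomputable def chartMap (s : Fin r → Bool) : MvPolynomial (Fin r) k →ₐ[k] FunField k r :=
  MvPolynomial.aeval (chartCoord k s)

@[simp]
theorem chartMap_X (s : Fin r → Bool) (i : Fin r) :
    chartMap k s (MvPolynomial.X i) = chartCoord k s i := by
  simp [chartMap]

theorem chartMap_injective (s : Fin r → Bool) : Function.Injective (chartMap k s) :=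
  algebraicIndependent_chartCoord k s

theorem chartMap_ne_zero (s : Fin r → Bool) {p : MvPolynomial (Fin r) k} (hp : p ≠ 0) :
    chartMap k s p ≠ 0 := by
  rwa [Ne, map_eq_zero_iff _ (chartMap_injective k s)]

theorem coe_chartEquiv (s : Fin r → Bool) (p : MvPolynomial (Fin r) k) :
    ((chartEquiv k s p : chart k s) : FunField k r) = chartMap k s p :=
  (algebraicIndependent_chartCoord k s).algebraMap_aevalEquiv p

/-- The point of the chart `s` with prime ideal `q`. -/
noncomputable def chartPoint (s : Fin r → Bool) (q : PrimeSpectrum (MvPolynomial (Fin r) k)) :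
    LocalSubring (FunField k r) :=
  LocalSubring.ofPrime (chart k s).toSubring (chartPrime k s q).asIdeal

theorem chartEquiv_mem_chartPrime (s : Fin r → Bool)
    (q : PrimeSpectrum (MvPolynomial (Fin r) k)) (p : MvPolynomial (Fin r) k) :
    (chartEquiv k s p : (chart k s).toSubring) ∈ (chartPrime k s q).asIdeal ↔ p ∈ q.asIdeal := by
  change (chartEquiv k s).symm (chartEquiv k s p) ∈ q.asIdeal ↔ _
  rw [AlgEquiv.symm_apply_apply]

variable {k}

theorem mem_chartPoint {s : Fin r → Bool} {q : PrimeSpectrum (MvPolynomial (Fin r) k)}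
    {x : FunField k r} : x ∈ (chartPoint k s q).toSubring ↔
      ∃ a b : MvPolynomial (Fin r) k, b ∉ q.asIdeal ∧ x = chartMap k s a / chartMap k s b := by
  rw [chartPoint, mem_ofPrime_iff]
  constructor
  · rintro ⟨a, b, hb, rfl⟩
    obtain ⟨a, rfl⟩ := (chartEquiv k s).surjective a
    obtain ⟨b, rfl⟩ := (chartEquiv k s).surjective b
    exact ⟨a, b, mt (chartEquiv_mem_chartPrime k s q b).2 hb, by simp only [coe_chartEquiv]⟩
  · rintro ⟨a, b, hb, rfl⟩
    exact ⟨chartEquiv k s a, chartEquiv k s b, mt (chartEquiv_mem_chartPrime k s q b).1 hb,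
      by simp only [coe_chartEquiv]⟩

theorem vanishes_chartPoint {s : Fin r → Bool} {q : PrimeSpectrum (MvPolynomial (Fin r) k)}
    {p : MvPolynomial (Fin r) k} :
    Vanishes (chartPoint k s q) (chartMap k s p) ↔ p ∈ q.asIdeal := by
  rw [← chartEquiv_mem_chartPrime k s q p, ← vanishes_ofPrime_iff, ← coe_chartEquiv]
  rfl

theorem chartMap_mem_chartPoint (s : Fin r → Bool) (q : PrimeSpectrum (MvPolynomial (Fin r) k))
    (p : MvPolynomial (Fin r) k) : chartMap k s p ∈ (chartPoint k s q).toSubring :=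
  mem_chartPoint.2 ⟨p, 1, q.2.one_notMem, by simp⟩

theorem chartCoord_mem_chartPoint (s : Fin r → Bool)
    (q : PrimeSpectrum (MvPolynomial (Fin r) k)) (i : Fin r) :
    chartCoord k s i ∈ (chartPoint k s q).toSubring :=
  chartMap_X k s i ▸ chartMap_mem_chartPoint s q _

theorem algebraMap_mem_chartPoint (s : Fin r → Bool)
    (q : PrimeSpectrum (MvPolynomial (Fin r) k)) (c : k) :
    algebraMap k _ c ∈ (chartPoint k s q).toSubring := by
  simpa using chartMap_mem_chartPoint s q (MvPolynomial.C c)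

theorem chartPoint_mem_P1Pow (s : Fin r → Bool) (q : PrimeSpectrum (MvPolynomial (Fin r) k)) :
    chartPoint k s q ∈ P1Pow k r := ⟨s, chartPrime k s q, rfl⟩

theorem exists_ofPrime_eq_chartPoint (s : Fin r → Bool) (p : Ideal (chart k s).toSubring)
    [hp : p.IsPrime] : ∃ q, LocalSubring.ofPrime (chart k s).toSubring p = chartPoint k s q := by
  let e : MvPolynomial (Fin r) k →+* (chart k s).toSubring := (chartEquiv k s).toRingEquiv
  refine ⟨PrimeSpectrum.comap e ⟨p, hp⟩, ?_⟩
  rw [chartPoint]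
  congr 1
  ext y
  change y ∈ p ↔ chartEquiv k s ((chartEquiv k s).symm y) ∈ p
  rw [AlgEquiv.apply_symm_apply]

theorem exists_eq_chartPoint {P : LocalSubring (FunField k r)} (hP : P ∈ P1Pow k r) :
    ∃ s q, P = chartPoint k s q := by
  obtain ⟨s, p, rfl⟩ := hP
  exact ⟨s, exists_ofPrime_eq_chartPoint s p.asIdeal⟩

theorem chart_le {s : Fin r → Bool} {B : Subring (FunField k r)}
    (hk : ∀ c : k, algebraMap k _ c ∈ B) (h : ∀ i, chartCoord k s i ∈ B) :
    (chart k s).toSubring ≤ B := by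
  intro x hx
  replace hx : x ∈ Algebra.adjoin k (Set.range (chartCoord k s)) := hx
  induction hx using Algebra.adjoin_induction with
  | mem x hx =>
    obtain ⟨i, rfl⟩ := hx
    exact h i
  | algebraMap c => exact hk c
  | add x y _ _ hx hy => exact add_mem hx hy
  | mul x y _ _ hx hy => exact mul_mem hx hy

theorem exists_eq_chartPoint_of_chartCoord_mem {P : LocalSubring (FunField k r)}
    (hP : P ∈ P1Pow k r) (s : Fin r → Bool) (h : ∀ i, chartCoord k s i ∈ P.toSubring) :
    ∃ q, P = chartPoint k s q := by
  have hle : (chart k s).toSubring ≤ P.toSubring := by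
    obtain ⟨t, q, rfl⟩ := exists_eq_chartPoint hP
    exact chart_le (algebraMap_mem_chartPoint t q) h
  obtain ⟨t, p, rfl⟩ := hP
  obtain ⟨q, hq⟩ := exists_ofPrime_eq_chartPoint s (centerIdeal _ _ hle)
  refine ⟨q, (ofPrime_eq_ofPrime_centerIdeal _ _ p.asIdeal hle (chart_le ?_ fun i => ?_)).trans hq⟩
  · exact fun c => LocalSubring.le_ofPrime _ _ ((chart k s).algebraMap_mem c)
  have hs : chartCoord k s i ∈ (chart k s).toSubring := Algebra.subset_adjoin ⟨i, rfl⟩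
  rcases chartCoord_eq_or_eq_inv k s t i with hst | hst
  · rw [hst]
    exact LocalSubring.le_ofPrime _ _ hs
  · have ht : chartCoord k t i ∈
        (LocalSubring.ofPrime (chart k t).toSubring p.asIdeal).toSubring :=
      LocalSubring.le_ofPrime _ _ (Algebra.subset_adjoin ⟨i, rfl⟩)
    refine (mem_ofPrime_iff _ _ _).2 ⟨1, ⟨_, hs⟩, ?_, by simp [hst]⟩
    rw [mem_centerIdeal]
    exact not_vanishes_of_inv_mem (chartCoord_ne_zero k s i) (hst ▸ ht)

end Charts

section PrimeDivisors

variable {k : Type*} [Field k] {r : ℕ}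

/-- The point of the prime spectrum generated by a prime element. -/
noncomputable def spanPrime {z : MvPolynomial (Fin r) k} (hz : Prime z) :
    PrimeSpectrum (MvPolynomial (Fin r) k) :=
  ⟨Ideal.span {z}, (Ideal.span_singleton_prime hz.ne_zero).2 hz⟩

theorem mem_spanPrime {z : MvPolynomial (Fin r) k} (hz : Prime z) {a : MvPolynomial (Fin r) k} :
    a ∈ (spanPrime hz).asIdeal ↔ z ∣ a := Ideal.mem_span_singleton

namespace PrimeDivisor

section

variable {s : Fin r → Bool} (Y : PrimeDivisor (P1Pow k r)) {z : MvPolynomial (Fin r) k}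

theorem dvd_of_mem_asIdeal {q : PrimeSpectrum (MvPolynomial (Fin r) k)}
    (hY : Y.ring.toLocalSubring = chartPoint k s q) (hz : Prime z) (hzq : z ∈ q.asIdeal)
    {a : MvPolynomial (Fin r) k} (ha : a ∈ q.asIdeal) : z ∣ a := by
  rcases eq_or_ne a 0 with rfl | ha0
  · exact dvd_zero z
  have hz0 := chartMap_ne_zero k s hz.ne_zero
  obtain ⟨n, hn⟩ := Y.exists_pow_div_mem_ring (chartMap_ne_zero k s ha0) hz0
    (hY ▸ vanishes_chartPoint.2 ha)
  rw [Y.mem_ring_iff_of_eq hY, mem_chartPoint] at hn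
  obtain ⟨c, d, hd, hcd⟩ := hn
  have hd0 : d ≠ 0 := fun h => hd (h ▸ zero_mem _)
  rw [div_eq_div_iff hz0 (chartMap_ne_zero k s hd0), ← map_pow, ← map_mul, ← map_mul] at hcd
  have hdvd : z ∣ a ^ n * d := ⟨c, by rw [chartMap_injective k s hcd, mul_comm]⟩
  exact hz.dvd_of_dvd_pow
    ((hz.dvd_or_dvd hdvd).resolve_right fun h => hd (Ideal.mem_of_dvd _ h hzq))

theorem toLocalSubring_eq_chartPoint (h : ∀ i, chartCoord k s i ∈ Y.ring) (hz : Prime z)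
    (hv : Vanishes Y.ring.toLocalSubring (chartMap k s z)) :
    Y.ring.toLocalSubring = chartPoint k s (spanPrime hz) := by
  obtain ⟨q, hq⟩ := exists_eq_chartPoint_of_chartCoord_mem Y.mem s h
  rw [hq, vanishes_chartPoint] at hv
  rw [hq]
  congr 1
  ext a
  rw [mem_spanPrime]
  exact ⟨Y.dvd_of_mem_asIdeal hq hz hv, fun ha => Ideal.mem_of_dvd _ ha hv⟩

theorem ord_chartMap_prime (hz : Prime z)
    (hY : Y.ring.toLocalSubring = chartPoint k s (spanPrime hz)) :
    Y.ord (chartMap k s z) = 1 := by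
  have hz0 := chartMap_ne_zero k s hz.ne_zero
  refine Y.ord_eq_one hz0 (hY ▸ vanishes_chartPoint.2 ((mem_spanPrime hz).2 dvd_rfl))
    fun f hf => ?_
  rw [hY] at hf
  rw [Y.mem_ring_iff_of_eq hY]
  obtain ⟨a, b, hb, rfl⟩ := mem_chartPoint.1 hf.mem
  have hb0 : chartMap k s b ≠ 0 := chartMap_ne_zero k s fun h => hb (h ▸ zero_mem _)
  have ha := hf.mul_right (chartMap_mem_chartPoint s (spanPrime hz) b)
  rw [div_mul_cancel₀ _ hb0, vanishes_chartPoint, mem_spanPrime] at ha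
  obtain ⟨c, rfl⟩ := ha
  refine mem_chartPoint.2 ⟨c, b, hb, ?_⟩
  rw [map_mul]
  field_simp

theorem ord_chartMap_of_not_dvd (hz : Prime z)
    (hY : Y.ring.toLocalSubring = chartPoint k s (spanPrime hz)) {p : MvPolynomial (Fin r) k}
    (hp : ¬ z ∣ p) : Y.ord (chartMap k s p) = 0 := by
  refine Y.ord_eq_zero_of_not_vanishes ?_ ?_
  · exact (Y.mem_ring_iff_of_eq hY).2 (chartMap_mem_chartPoint _ _ _)
  · rwa [hY, vanishes_chartPoint, mem_spanPrime]

end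

/-- The prime divisor `Y` meets the affine chart on which all `Z_i` are nonzero. -/
def IsAffine (Y : PrimeDivisor (P1Pow k r)) : Prop := ∀ i, coord k i ∈ Y.ring

theorem coord_mem_of_notMem (Y : PrimeDivisor (P1Pow k r)) {i j : Fin r} (hij : j ≠ i)
    (hi : coord k i ∉ Y.ring) : coord k j ∈ Y.ring := by
  by_contra hj
  obtain ⟨s, q, hq⟩ := exists_eq_chartPoint Y.mem
  have hs (l : Fin r) : chartCoord k s l ∈ Y.ring :=
    (Y.mem_ring_iff_of_eq hq).2 (chartCoord_mem_chartPoint s q l)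
  have hX (l : Fin r) (hl : coord k l ∉ Y.ring) :
      (MvPolynomial.X l : MvPolynomial (Fin r) k) ∈ q.asIdeal := by
    rcases chartCoord_eq_or_eq_inv k (fun _ => false) s l with h | h
    · exact absurd (show chartCoord k s l ∈ Y.ring from hs l) (by rwa [h])
    · rw [← vanishes_chartPoint (s := s), chartMap_X, h, ← hq]
      exact vanishes_inv_of_notMem _ hl
  have hdvd := Y.dvd_of_mem_asIdeal hq MvPolynomial.X_prime (hX i hi) (hX j hj)
  rw [MvPolynomial.X_dvd_X] at hdvd
  exact hij hdvd.symm

theorem eq_polarDivisor (Y : PrimeDivisor (P1Pow k r)) {i : Fin r} (hi : coord k i ∉ Y.ring) :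
    Y = polarDivisor k i := by
  have hv := vanishes_inv_of_notMem _ hi
  refine eq_of_toLocalSubring_eq (Y.toLocalSubring_eq_chartPoint (s := invChart i) (fun j => ?_)
    MvPolynomial.X_prime (by rwa [chartMap_X, chartCoord_invChart_self]))
  by_cases hj : j = i
  · rw [hj, chartCoord_invChart_self]
    exact hv.mem
  · rw [chartCoord_invChart_of_ne k hj]
    exact Y.coord_mem_of_notMem hj hi

theorem isAffine_or_eq_polarDivisor (Y : PrimeDivisor (P1Pow k r)) :
    Y.IsAffine ∨ ∃ i, Y = polarDivisor k i := by
  refine or_iff_not_imp_left.2 fun h => ?_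
  obtain ⟨i, hi⟩ := not_forall.1 h
  exact ⟨i, Y.eq_polarDivisor hi⟩

end PrimeDivisor

theorem polarDivisor_toLocalSubring (i : Fin r) :
    (polarDivisor k i).ring.toLocalSubring =
      chartPoint k (invChart i) (spanPrime (MvPolynomial.X_prime (i := i))) := rfl

theorem ord_polarDivisor_inv_coord (i : Fin r) : (polarDivisor k i).ord (coord k i)⁻¹ = 1 := by
  rw [← chartCoord_invChart_self, ← chartMap_X]
  exact PrimeDivisor.ord_chartMap_prime _ MvPolynomial.X_prime (polarDivisor_toLocalSubring i)

theorem coord_notMem_polarDivisor (i : Fin r) : coord k i ∉ (polarDivisor k i).ring := by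
  rw [PrimeDivisor.mem_ring_iff _ (coord_ne_zero k i)]
  have := ord_polarDivisor_inv_coord (k := k) i
  rw [PrimeDivisor.ord_inv] at this
  omega

theorem polarDivisor_injective : Function.Injective (polarDivisor k : Fin r → _) := by
  intro i j h
  by_contra hij
  exact coord_notMem_polarDivisor j
    (h ▸ PrimeDivisor.coord_mem_of_notMem _ (Ne.symm hij) (coord_notMem_polarDivisor i))

end PrimeDivisors

theorem exists_prime_dvd_mem_of_isPrime {R : Type*} [CommRing R] [IsDomain R]
    [UniqueFactorizationMonoid R] {q : Ideal R} (hq : q.IsPrime) {b : R} (hb : b ≠ 0)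
    (hbq : b ∈ q) : ∃ z, Prime z ∧ z ∣ b ∧ z ∈ q := by
  obtain ⟨s, hs, hsb⟩ := UniqueFactorizationMonoid.exists_prime_factors b hb
  obtain ⟨z, hzs, hzq⟩ := (hq.multiset_prod_mem_iff_exists_mem s).1
    (Ideal.mem_of_dvd _ hsb.symm.dvd hbq)
  exact ⟨z, hs z hzs, (Multiset.dvd_prod hzs).trans hsb.dvd, hzq⟩

section AffineChart

variable {k : Type*} [Field k] {r : ℕ}

/-- The embedding of the coordinate ring of the affine chart on which all `Z_i` are nonzero. -/
noncomputable abbrev affineMap : MvPolynomial (Fin r) k →+* FunField k r :=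
  algebraMap (MvPolynomial (Fin r) k) (FunField k r)

theorem affineMap_ne_zero {p : MvPolynomial (Fin r) k} (hp : p ≠ 0) : affineMap p ≠ 0 := by
  simpa using hp

theorem chartMap_affine (p : MvPolynomial (Fin r) k) :
    chartMap k (fun _ => false) p = affineMap p := by
  have : chartMap k (fun _ => false) =
      IsScalarTower.toAlgHom k (MvPolynomial (Fin r) k) (FunField k r) := by
    ext i
    simp [chartCoord, coord]
  rw [this]
  rfl

theorem affineMap_mem_chartPoint (q : PrimeSpectrum (MvPolynomial (Fin r) k))
    (p : MvPolynomial (Fin r) k) :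
    affineMap p ∈ (chartPoint k (fun _ => false) q).toSubring :=
  chartMap_affine p ▸ chartMap_mem_chartPoint _ q p

theorem vanishes_chartPoint_affineMap {q : PrimeSpectrum (MvPolynomial (Fin r) k)}
    {p : MvPolynomial (Fin r) k} :
    Vanishes (chartPoint k (fun _ => false) q) (affineMap p) ↔ p ∈ q.asIdeal := by
  rw [← chartMap_affine, vanishes_chartPoint]

theorem div_mem_chartPoint {q : PrimeSpectrum (MvPolynomial (Fin r) k)}
    {a b : MvPolynomial (Fin r) k} (hb : b ∉ q.asIdeal) :
    affineMap a / affineMap b ∈ (chartPoint k (fun _ => false) q).toSubring :=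
  mem_chartPoint.2 ⟨a, b, hb, by rw [chartMap_affine, chartMap_affine]⟩

theorem exists_isRelPrime_eq_div (f : FunField k r) : ∃ a b : MvPolynomial (Fin r) k, b ≠ 0 ∧
    IsRelPrime a b ∧ f = affineMap a / affineMap b := by
  obtain ⟨a, b, hab, rfl⟩ := IsFractionRing.exists_reduced_fraction
    (A := MvPolynomial (Fin r) k) f
  exact ⟨a, b, nonZeroDivisors.coe_ne_zero b, hab, by rw [IsFractionRing.mk'_eq_div]⟩

/-- The closure in `(ℙ¹)^r` of the hypersurface defined by a prime polynomial. -/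
noncomputable def hypersurface {z : MvPolynomial (Fin r) k} (hz : Prime z) :
    PrimeDivisor (P1Pow k r) where
  ring :=
    { (chartPoint k (fun _ => false) (spanPrime hz)).toSubring with
      mem_or_inv_mem' := by
        intro f
        obtain ⟨a, b, -, hab, rfl⟩ := exists_isRelPrime_eq_div f
        by_cases h : z ∣ b
        · right
          rw [inv_div]
          exact div_mem_chartPoint fun ha => hz.not_isUnit (hab ((mem_spanPrime hz).1 ha) h)
        · left
          exact div_mem_chartPoint fun hb => h ((mem_spanPrime hz).1 hb) }
  isDVR := by
    let e : MvPolynomial (Fin r) k ≃+* (chart k fun _ => false).toSubring :=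
      (chartEquiv k _).toRingEquiv
    have hN : IsNoetherianRing (chart k fun _ => false).toSubring :=
      isNoetherianRing_of_ringEquiv _ e
    have hcomap : (chartPrime k (fun _ => false) (spanPrime hz)).asIdeal =
        (Ideal.span {z}).comap e.symm := rfl
    refine isDVR_ofPrime (chart k fun _ => false).toSubring _ (e z) (by simpa using hz.ne_zero) ?_
    rw [hcomap, Ideal.comap_symm, Ideal.map_span, Set.image_singleton]
  mem := chartPoint_mem_P1Pow _ _

theorem hypersurface_toLocalSubring {z : MvPolynomial (Fin r) k} (hz : Prime z) :
    (hypersurface hz).ring.toLocalSubring = chartPoint k (fun _ => false) (spanPrime hz) := rfl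

theorem isAffine_hypersurface {z : MvPolynomial (Fin r) k} (hz : Prime z) :
    (hypersurface hz).IsAffine := fun _ => affineMap_mem_chartPoint (spanPrime hz) _

theorem ord_hypersurface_of_not_dvd {z p : MvPolynomial (Fin r) k} (hz : Prime z)
    (hp : ¬ z ∣ p) : (hypersurface hz).ord (affineMap p) = 0 :=
  chartMap_affine p ▸
    PrimeDivisor.ord_chartMap_of_not_dvd _ hz (hypersurface_toLocalSubring hz) hp

theorem through_hypersurface {z : MvPolynomial (Fin r) k} (hz : Prime z)
    {q : PrimeSpectrum (MvPolynomial (Fin r) k)} (hzq : z ∈ q.asIdeal) :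
    (hypersurface hz).Through (chartPoint k (fun _ => false) q) := by
  intro x hx
  obtain ⟨a, b, hb, rfl⟩ := mem_chartPoint.1 hx
  exact mem_chartPoint.2
    ⟨a, b, fun h => hb (Ideal.mem_of_dvd _ ((mem_spanPrime hz).1 h) hzq), rfl⟩

namespace PrimeDivisor.IsAffine

variable {Y : PrimeDivisor (P1Pow k r)}

theorem exists_eq_chartPoint (hY : Y.IsAffine) :
    ∃ q, Y.ring.toLocalSubring = chartPoint k (fun _ => false) q :=
  exists_eq_chartPoint_of_chartCoord_mem Y.mem (fun _ => false) hY

theorem affineMap_mem (hY : Y.IsAffine) (p : MvPolynomial (Fin r) k) : affineMap p ∈ Y.ring := by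
  obtain ⟨q, hq⟩ := hY.exists_eq_chartPoint
  exact (Y.mem_ring_iff_of_eq hq).2 (affineMap_mem_chartPoint q p)

theorem ord_affineMap_nonneg (hY : Y.IsAffine) (p : MvPolynomial (Fin r) k) :
    0 ≤ Y.ord (affineMap p) :=
  Y.ord_nonneg_of_mem (hY.affineMap_mem p)

theorem eq_hypersurface (hY : Y.IsAffine) {z : MvPolynomial (Fin r) k} (hz : Prime z)
    (hv : Vanishes Y.ring.toLocalSubring (affineMap z)) : Y = hypersurface hz :=
  eq_of_toLocalSubring_eq (Y.toLocalSubring_eq_chartPoint (s := fun _ => false) hY hz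
    (by rwa [chartMap_affine]))

theorem exists_eq_hypersurface (hY : Y.IsAffine) :
    ∃ (z : MvPolynomial (Fin r) k) (hz : Prime z), Y = hypersurface hz := by
  obtain ⟨q, hq⟩ := hY.exists_eq_chartPoint
  obtain ⟨ϖ, hϖ0, -, hϖ, -⟩ := Y.exists_uniformizer
  rw [hq] at hϖ
  obtain ⟨a, b, hb, rfl⟩ := mem_chartPoint.1 hϖ.mem
  have hb0 := chartMap_ne_zero k (fun _ => false) fun h : b = 0 => hb (h ▸ zero_mem _)
  have haq : a ∈ q.asIdeal := by
    have := hϖ.mul_right (chartMap_mem_chartPoint _ q b)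
    rwa [div_mul_cancel₀ _ hb0, vanishes_chartPoint] at this
  have ha0 : a ≠ 0 := by
    rintro rfl
    simp at hϖ0
  obtain ⟨z, hz, -, hzq⟩ := exists_prime_dvd_mem_of_isPrime q.2 ha0 haq
  exact ⟨z, hz, hY.eq_hypersurface hz (hq ▸ vanishes_chartPoint_affineMap.2 hzq)⟩

theorem ord_prime (hY : Y.IsAffine) {z : MvPolynomial (Fin r) k} (hz : Prime z)
    [Decidable (hypersurface hz = Y)] :
    Y.ord (affineMap z) = if hypersurface hz = Y then 1 else 0 := by
  split_ifs with h
  · rw [← h, ← chartMap_affine]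
    exact ord_chartMap_prime _ hz (hypersurface_toLocalSubring hz)
  · exact Y.ord_eq_zero_of_not_vanishes (hY.affineMap_mem z)
      fun hv => h (hY.eq_hypersurface hz hv).symm

theorem ord_eq_zero_or_of_isRelPrime (hY : Y.IsAffine) {a b : MvPolynomial (Fin r) k}
    (hab : IsRelPrime a b) : Y.ord (affineMap a) = 0 ∨ Y.ord (affineMap b) = 0 := by
  obtain ⟨z, hz, rfl⟩ := hY.exists_eq_hypersurface
  by_cases hza : z ∣ a
  · exact Or.inr (ord_hypersurface_of_not_dvd hz fun hzb => hz.not_isUnit (hab hza hzb))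
  · exact Or.inl (ord_hypersurface_of_not_dvd hz hza)

end PrimeDivisor.IsAffine

theorem ord_hypersurface_div_neg {a b z : MvPolynomial (Fin r) k} (hb : b ≠ 0)
    (hab : IsRelPrime a b) (hz : Prime z) (hzb : z ∣ b) :
    (hypersurface hz).ord (affineMap a / affineMap b) < 0 := by
  have hza : ¬ z ∣ a := fun h => hz.not_isUnit (hab h hzb)
  have ha : a ≠ 0 := fun h => hza (h ▸ dvd_zero z)
  have hpos : 0 < (hypersurface hz).ord (affineMap b) := by
    refine PrimeDivisor.ord_pos_of_vanishes _ (affineMap_ne_zero hb) ?_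
    rwa [hypersurface_toLocalSubring, vanishes_chartPoint_affineMap, mem_spanPrime]
  rw [PrimeDivisor.ord_div _ (affineMap_ne_zero ha) (affineMap_ne_zero hb),
    ord_hypersurface_of_not_dvd hz hza]
  omega

theorem exists_affineMap_eq {f : FunField k r}
    (h : ∀ Y : PrimeDivisor (P1Pow k r), Y.IsAffine → 0 ≤ Y.ord f) : ∃ p, f = affineMap p := by
  obtain ⟨a, b, hb, hab, rfl⟩ := exists_isRelPrime_eq_div f
  have hu : IsUnit b := by
    by_contra hu
    obtain ⟨z, hz, hzb⟩ := WfDvdMonoid.exists_irreducible_factor hu hb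
    exact (h _ (isAffine_hypersurface hz.prime)).not_gt
      (ord_hypersurface_div_neg hb hab hz.prime hzb)
  obtain ⟨c, hc⟩ := hu.exists_right_inv
  refine ⟨a * c, ?_⟩
  rw [div_eq_iff (affineMap_ne_zero hb), ← map_mul, mul_assoc, mul_comm c, hc, mul_one]

theorem mem_chartPoint_of_ord_nonneg {q : PrimeSpectrum (MvPolynomial (Fin r) k)}
    {f : FunField k r} (h : ∀ Y : PrimeDivisor (P1Pow k r), Y.IsAffine →
      Y.Through (chartPoint k (fun _ => false) q) → 0 ≤ Y.ord f) :
    f ∈ (chartPoint k (fun _ => false) q).toSubring := by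
  obtain ⟨a, b, hb, hab, rfl⟩ := exists_isRelPrime_eq_div f
  refine div_mem_chartPoint fun hbq => ?_
  obtain ⟨z, hz, hzb, hzq⟩ := exists_prime_dvd_mem_of_isPrime q.2 hb hbq
  exact (h _ (isAffine_hypersurface hz) (through_hypersurface hz hzq)).not_gt
    (ord_hypersurface_div_neg hb hab hz hzb)

theorem exists_ord_eq_divisor (G : Divisor (P1Pow k r)) : ∃ H : FunField k r, H ≠ 0 ∧
    ∀ Y : PrimeDivisor (P1Pow k r), Y.IsAffine → Y.ord H = G Y := by
  classical
  have hequation (Y : PrimeDivisor (P1Pow k r)) : ∃ f : FunField k r, f ≠ 0 ∧ (Y.IsAffine →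
      ∀ Z : PrimeDivisor (P1Pow k r), Z.IsAffine → Z.ord f = if Y = Z then 1 else 0) := by
    by_cases hY : Y.IsAffine
    · obtain ⟨z, hz, rfl⟩ := hY.exists_eq_hypersurface
      exact ⟨affineMap z, affineMap_ne_zero hz.ne_zero, fun _ Z hZ => hZ.ord_prime hz⟩
    · exact ⟨1, one_ne_zero, fun h => absurd h hY⟩
  choose f hf0 hf using hequation
  refine ⟨∏ Y ∈ G.support.filter (·.IsAffine), f Y ^ G Y,
    Finset.prod_ne_zero_iff.2 fun Y _ => zpow_ne_zero _ (hf0 Y), fun Z hZ => ?_⟩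
  calc Z.ord (∏ Y ∈ G.support.filter (·.IsAffine), f Y ^ G Y)
      = ∑ Y ∈ G.support.filter (·.IsAffine), Z.ord (f Y ^ G Y) :=
        Z.ord_prod _ _ fun Y _ => zpow_ne_zero _ (hf0 Y)
    _ = ∑ Y ∈ G.support.filter (·.IsAffine), if Y = Z then G Y else 0 :=
        Finset.sum_congr rfl fun Y hY => by
          rw [Z.ord_zpow, hf Y (Finset.mem_filter.1 hY).2 Z hZ, mul_ite, mul_one, mul_zero]
    _ = G Z := by
        rw [Finset.sum_ite_eq', ite_eq_left_iff]
        simp only [Finset.mem_filter, hZ, and_true, Finsupp.mem_support_iff, not_not]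
        exact Eq.symm

theorem exists_ord_eq_max {θ : FunField k r} (hθ : θ ≠ 0) : ∃ H : FunField k r, H ≠ 0 ∧
    ∀ Y : PrimeDivisor (P1Pow k r), Y.IsAffine → Y.ord H = max (Y.ord θ) 0 := by
  obtain ⟨a, b, hb, hab, rfl⟩ := exists_isRelPrime_eq_div θ
  have ha : a ≠ 0 := by
    rintro rfl
    simp at hθ
  refine ⟨affineMap a, affineMap_ne_zero ha, fun Y hY => ?_⟩
  rw [Y.ord_div (affineMap_ne_zero ha) (affineMap_ne_zero hb)]
  have := hY.ord_affineMap_nonneg a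
  have := hY.ord_affineMap_nonneg b
  have := hY.ord_eq_zero_or_of_isRelPrime hab
  omega

end AffineChart

section Degrees

variable {k : Type*} [Field k] {r : ℕ}

/-- The polynomial `T_i ^ d * p(…, T_i⁻¹, …)`, which expresses `p / x_i ^ d` in the chart
`invChart i`; it is meaningful for `d` at least the degree of `p` in the `i`-th variable, because
the subtraction of exponents is truncated. -/
noncomputable def invertVar (i : Fin r) (d : ℕ) (p : MvPolynomial (Fin r) k) :
    MvPolynomial (Fin r) k :=
  ∑ e ∈ p.support, MvPolynomial.monomial (e.update i (d - e i)) (p.coeff e)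

theorem chartMap_invChart_monomial_update (i : Fin r) {d : ℕ} {e : Fin r →₀ ℕ} (he : e i ≤ d)
    (c : k) :
    chartMap k (invChart i) (MvPolynomial.monomial (e.update i (d - e i)) c) =
      affineMap (MvPolynomial.monomial e c) * (coord k i)⁻¹ ^ d := by
  have hx := coord_ne_zero k i
  have hprod : ∏ j ∈ Finset.univ.erase i, chartCoord k (invChart i) j ^ e.update i (d - e i) j =
      ∏ j ∈ Finset.univ.erase i, chartCoord k (fun _ => false) j ^ e j :=
    Finset.prod_congr rfl fun j hj => by
      have hji := Finset.ne_of_mem_erase hj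
      rw [chartCoord_invChart_of_ne k hji, Finsupp.update_apply, if_neg hji]
      rfl
  have hcoord : (coord k i)⁻¹ ^ (d - e i) = coord k i ^ e i * (coord k i)⁻¹ ^ d := by
    rw [pow_sub₀ _ (inv_ne_zero hx) he, inv_pow, inv_pow, inv_inv, mul_comm]
  rw [← chartMap_affine, chartMap, chartMap, MvPolynomial.aeval_monomial,
    MvPolynomial.aeval_monomial, Finsupp.prod_fintype _ _ fun _ => pow_zero _,
    Finsupp.prod_fintype _ _ fun _ => pow_zero _, ← Finset.mul_prod_erase _ _ (Finset.mem_univ i),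
    ← Finset.mul_prod_erase _ _ (Finset.mem_univ i), hprod, chartCoord_invChart_self,
    Finsupp.update_apply, if_pos rfl, hcoord]
  simp only [chartCoord, Bool.false_eq_true, if_false]
  ring

theorem chartMap_invertVar {i : Fin r} {d : ℕ} {p : MvPolynomial (Fin r) k}
    (hd : p.degreeOf i ≤ d) :
    chartMap k (invChart i) (invertVar i d p) = affineMap p * (coord k i)⁻¹ ^ d := by
  conv_rhs => rw [p.as_sum, map_sum, Finset.sum_mul]
  rw [invertVar, map_sum]
  exact Finset.sum_congr rfl fun e he =>
    chartMap_invChart_monomial_update i (MvPolynomial.degreeOf_le_iff.1 hd e he) _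

theorem not_X_dvd_invertVar (i : Fin r) {p : MvPolynomial (Fin r) k} (hp : p ≠ 0) :
    ¬ MvPolynomial.X i ∣ invertVar i (p.degreeOf i) p := by
  obtain ⟨e, he, hei⟩ : ∃ e ∈ p.support, e i = p.degreeOf i := by
    obtain ⟨e, he, h⟩ := Finset.exists_mem_eq_sup p.support
      (MvPolynomial.support_nonempty.2 hp) fun e => e i
    exact ⟨e, he, by rw [MvPolynomial.degreeOf_eq_sup, h]⟩
  have hcoeff : (invertVar i (p.degreeOf i) p).coeff (e.update i 0) = p.coeff e := by
    rw [invertVar, MvPolynomial.coeff_sum, Finset.sum_eq_single e]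
    · rw [hei, Nat.sub_self, MvPolynomial.coeff_monomial, if_pos rfl]
    · intro e' he' hne
      rw [MvPolynomial.coeff_monomial, if_neg]
      intro h
      have hle := MvPolynomial.monomial_le_degreeOf i he'
      refine hne (Finsupp.ext fun j => ?_)
      have hj := DFunLike.congr_fun h j
      have hi := DFunLike.congr_fun h i
      simp only [Finsupp.update_apply, if_true] at hi hj
      split_ifs at hj with hji
      · subst hji
        omega
      · exact hj
    · exact fun h => absurd he h
  rintro ⟨w, hw⟩
  rw [hw, MvPolynomial.coeff_X_mul', if_neg (by simp)] at hcoeff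
  exact MvPolynomial.mem_support_iff.1 he hcoeff.symm

theorem ord_polarDivisor_affineMap (i : Fin r) {p : MvPolynomial (Fin r) k} (hp : p ≠ 0) :
    (polarDivisor k i).ord (affineMap p) = -(p.degreeOf i : ℤ) := by
  have h := PrimeDivisor.ord_chartMap_of_not_dvd (polarDivisor k i)
    (MvPolynomial.X_prime (i := i)) (polarDivisor_toLocalSubring i) (not_X_dvd_invertVar i hp)
  rw [chartMap_invertVar le_rfl, PrimeDivisor.ord_mul _ (affineMap_ne_zero hp)
    (pow_ne_zero _ (inv_ne_zero (coord_ne_zero k i))), PrimeDivisor.ord_pow,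
    ord_polarDivisor_inv_coord] at h
  omega

variable (k) in
/-- The polynomials of degree at most `n i` in the `i`-th variable. Negative bounds are allowed;
they leave only the zero polynomial. -/
def polySpace (n : Fin r → ℤ) : Set (MvPolynomial (Fin r) k) :=
  {p | ∀ e ∈ p.support, ∀ i, (e i : ℤ) ≤ n i}

theorem zero_mem_polySpace (n : Fin r → ℤ) : 0 ∈ polySpace k n := by
  simp [polySpace]

theorem mem_polySpace_iff {n : Fin r → ℤ} {p : MvPolynomial (Fin r) k} (hp : p ≠ 0) :
    p ∈ polySpace k n ↔ ∀ i, (p.degreeOf i : ℤ) ≤ n i := by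
  obtain ⟨e, he⟩ := MvPolynomial.support_nonempty.2 hp
  refine ⟨fun h i => ?_, fun h e he i => ?_⟩
  · have hle : p.degreeOf i ≤ (n i).toNat :=
      MvPolynomial.degreeOf_le_iff.2 fun e he => by
        have := h e he i
        omega
    have := h e he i
    omega
  · have := MvPolynomial.monomial_le_degreeOf i he
    have := h i
    omega

theorem mem_rrSpace_iff {W : PrimeDivisor (P1Pow k r) → ℤ} {H : FunField k r} (hH : H ≠ 0)
    (hW : ∀ Y : PrimeDivisor (P1Pow k r), Y.IsAffine → Y.ord H = W Y) {f : FunField k r} :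
    f ∈ rrSpace W ↔ ∃ p ∈ polySpace k fun i => W (polarDivisor k i) - (polarDivisor k i).ord H,
      f = affineMap p / H := by
  rcases eq_or_ne f 0 with rfl | hf
  · exact iff_of_true (Or.inl rfl) ⟨0, zero_mem_polySpace _, by simp⟩
  constructor
  · intro h
    replace h := h.resolve_left hf
    obtain ⟨p, hp⟩ : ∃ p, f * H = affineMap p := exists_affineMap_eq fun Y hY => by
      rw [Y.ord_mul hf hH, hW Y hY]
      exact h Y
    have hp0 : p ≠ 0 := by
      rintro rfl
      exact mul_ne_zero hf hH (hp.trans (map_zero _))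
    refine ⟨p, (mem_polySpace_iff hp0).2 fun i => ?_, by rw [← hp, mul_div_cancel_right₀ _ hH]⟩
    have hi := h (polarDivisor k i)
    have hfH := ord_polarDivisor_affineMap i hp0
    rw [← hp, PrimeDivisor.ord_mul _ hf hH] at hfH
    omega
  · rintro ⟨p, hp, rfl⟩
    have hp0 : p ≠ 0 := by
      rintro rfl
      simp at hf
    refine Or.inr fun Y => ?_
    rw [Y.ord_div (affineMap_ne_zero hp0) hH]
    rcases Y.isAffine_or_eq_polarDivisor with hY | ⟨i, rfl⟩
    · have := hY.ord_affineMap_nonneg p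
      rw [hW Y hY]
      omega
    · have := (mem_polySpace_iff hp0).1 hp i
      rw [ord_polarDivisor_affineMap i hp0]
      omega

end Degrees

section EvaluationCodes

theorem sum_eq_zero_of_sum_update_eq_zero {σ κ M : Type*} [Fintype σ] [DecidableEq σ] [Fintype κ]
    [AddCommMonoid M] {G : (σ → κ) → M} (j : σ)
    (hG : ∀ α, ∑ t, G (Function.update α j t) = 0) : ∑ α, G α = 0 := by
  classical
  rw [← (Equiv.funSplitAt j κ).symm.sum_comp, Fintype.sum_prod_type_right]
  refine Finset.sum_eq_zero fun β _ => ?_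
  rcases isEmpty_or_nonempty κ with hκ | ⟨⟨t₀⟩⟩
  · exact Finset.sum_of_isEmpty _
  rw [← hG ((Equiv.funSplitAt j κ).symm (t₀, β))]
  refine Finset.sum_congr rfl fun t _ => congrArg G (funext fun i => ?_)
  rcases eq_or_ne i j with rfl | hi
  · simp [Equiv.funSplitAt, Equiv.piSplitAt]
  · simp [Equiv.funSplitAt, Equiv.piSplitAt, hi]

variable {k : Type*} [Field k] {r : ℕ}

/-- The code of all words `w α * p(α)`, where `p` runs through the polynomials of degree at most
`n i` in the `i`-th variable. -/
def evaluationCode (w : (Fin r → k) → k) (n : Fin r → ℤ) : Set ((Fin r → k) → k) :=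
  {v | ∃ p ∈ polySpace k n, ∀ α, v α = w α * MvPolynomial.eval α p}

theorem one_mem_evaluationCode_one (m : Fin r → ℕ) :
    1 ∈ evaluationCode (1 : (Fin r → k) → k) fun i => m i := by
  refine ⟨1, (mem_polySpace_iff one_ne_zero).2 fun i => ?_, fun α => by simp⟩
  simp

theorem dualCode_ne_univ {ι : Type*} [Fintype ι] [Nonempty ι] {C : Set (ι → k)} (hC : 1 ∈ C) :
    dualCode C ≠ Set.univ := by
  classical
  intro h
  obtain ⟨i⟩ := ‹Nonempty ι›
  have hi : Pi.single i 1 ∈ dualCode C := h ▸ Set.mem_univ _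
  simpa using hi 1 hC

variable [Fintype k]

section Sums

variable {σ : Type*} [DecidableEq σ] {p : MvPolynomial σ k} {j : σ}

theorem sum_eval_update_eq_zero [Finite σ] (hp : ∀ e ∈ p.support, e j < Fintype.card k - 1)
    (α : σ → k) :
    ∑ t, MvPolynomial.eval (Function.update α j t) p = 0 := by
  cases nonempty_fintype σ
  simp_rw [MvPolynomial.eval_eq']
  rw [Finset.sum_comm]
  refine Finset.sum_eq_zero fun e he => ?_
  have hmonomial (t : k) : p.coeff e * ∏ i, Function.update α j t i ^ e i =
      t ^ e j * (p.coeff e * ∏ i ∈ Finset.univ.erase j, α i ^ e i) := by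
    rw [← Finset.mul_prod_erase _ _ (Finset.mem_univ j), Function.update_self,
      Finset.prod_congr rfl fun i hi => by rw [Function.update_of_ne (Finset.ne_of_mem_erase hi)]]
    ring
  simp_rw [hmonomial]
  rw [← Finset.sum_mul, FiniteField.sum_pow_lt_card_sub_one k _ (hp e he), zero_mul]

theorem sum_eval_mul_eq_zero [Fintype σ] (hp : ∀ e ∈ p.support, e j < Fintype.card k - 1)
    {φ : (σ → k) → k} (hφ : ∀ α t, φ (Function.update α j t) = φ α) :
    ∑ α, MvPolynomial.eval α p * φ α = 0 :=
  sum_eq_zero_of_sum_update_eq_zero j fun α => by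
    simp_rw [hφ]
    rw [← Finset.sum_mul, sum_eval_update_eq_zero hp, zero_mul]

end Sums

theorem evaluationCode_eq_univ {w : (Fin r → k) → k} (hw : ∀ α, w α ≠ 0) {n : Fin r → ℤ}
    (hn : ∀ i, (Fintype.card k : ℤ) - 1 ≤ n i) : evaluationCode w n = Set.univ := by
  refine Set.eq_univ_of_forall fun v => ?_
  obtain ⟨p, hp, hpv⟩ : (fun α => (w α)⁻¹ * v α) ∈
      (MvPolynomial.restrictDegree (Fin r) k (Fintype.card k - 1)).map
        (MvPolynomial.evalₗ k (Fin r)) := by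
    rw [MvPolynomial.map_restrict_dom_evalₗ]
    exact Submodule.mem_top
  refine ⟨p, fun e he i => ?_, fun α => ?_⟩
  · have hdeg := (MvPolynomial.mem_restrictDegree _ _ _).1 hp e he i
    have := hn i
    have := Fintype.card_pos (α := k)
    omega
  · have hval : MvPolynomial.eval α p = (w α)⁻¹ * v α := congrFun hpv α
    rw [hval, mul_inv_cancel_left₀ (hw α)]

theorem hyperplane_mem_dualCode {i j : Fin r} (hij : i ≠ j) {n : Fin r → ℤ}
    (hj : n j + 1 < Fintype.card k) [DecidableEq k] :
    (fun α => if α i = 0 then 1 else 0) ∈ dualCode (evaluationCode (1 : (Fin r → k) → k) n) := by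
  rintro v ⟨p, hp, hv⟩
  simp only [dotProduct, hv, Pi.one_apply, one_mul]
  refine sum_eval_mul_eq_zero (j := j) (fun e he => ?_) fun α t => ?_
  · have := hp e he j
    omega
  · rw [Function.update_of_ne hij]

theorem hyperplane_notMem_evaluationCode {w : (Fin r → k) → k} (hw : ∀ α, w α ≠ 0)
    {n : Fin r → ℤ} {i : Fin r} (hi : n i + 1 < Fintype.card k) [DecidableEq k] :
    (fun α => if α i = 0 then 1 else 0) ∉ evaluationCode w n := by
  rintro ⟨p, hp, hv⟩
  have hline : ∑ t, MvPolynomial.eval (Function.update 0 i t) p = 0 :=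
    sum_eval_update_eq_zero (fun e he => by
      have := hp e he i
      omega) 0
  have hzero (t : k) (ht : t ≠ 0) : MvPolynomial.eval (Function.update 0 i t) p = 0 := by
    have := hv (Function.update 0 i t)
    simp only [Function.update_self, if_neg ht] at this
    exact (mul_eq_zero.1 this.symm).resolve_left (hw _)
  have hupdate : Function.update (0 : Fin r → k) i 0 = 0 := Function.update_eq_self i 0
  have hone := hv 0
  rw [Fintype.sum_eq_single 0 hzero, hupdate] at hline
  simp only [hline, mul_zero, Pi.zero_apply, if_true, one_ne_zero] at hone

theorem dualCode_ne_evaluationCode {m : Fin r → ℕ} {i j : Fin r} (hij : i ≠ j)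
    (hi : m i + 1 < Fintype.card k) (hj : m j + 1 < Fintype.card k) {w : (Fin r → k) → k}
    (hw : ∀ α, w α ≠ 0) (n : Fin r → ℤ) :
    dualCode (evaluationCode (1 : (Fin r → k) → k) fun i => m i) ≠ evaluationCode w n := by
  classical
  intro h
  by_cases hn : ∀ l, (Fintype.card k : ℤ) - 1 ≤ n l
  · exact dualCode_ne_univ (one_mem_evaluationCode_one m) (h.trans (evaluationCode_eq_univ hw hn))
  push Not at hn
  obtain ⟨l, hl⟩ := hn
  obtain ⟨l', hl', hml'⟩ : ∃ l', l ≠ l' ∧ m l' + 1 < Fintype.card k := by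
    rcases eq_or_ne l i with rfl | hli
    · exact ⟨j, hij, hj⟩
    · exact ⟨i, hli, hi⟩
  exact hyperplane_notMem_evaluationCode hw (by omega)
    (h ▸ hyperplane_mem_dualCode hl' (by exact_mod_cast hml'))

end EvaluationCodes

section Values

variable {k K : Type*} [Field k] [Field K] [Algebra k K] {P : LocalSubring K}

theorem hasValue_iff_vanishes {f : K} {c : k} :
    HasValue k P f c ↔ Vanishes P (f - algebraMap k K c) := Iff.rfl

theorem hasValue_zero_iff {f : K} : HasValue k P f 0 ↔ Vanishes P f := by
  rw [hasValue_iff_vanishes, map_zero, sub_zero]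

variable (hk : ∀ c : k, algebraMap k K c ∈ P.toSubring) {f g : K} {c d : k}
include hk

theorem vanishes_algebraMap_iff : Vanishes P (algebraMap k K c) ↔ c = 0 := by
  refine ⟨fun h => ?_, ?_⟩
  · by_contra hc
    refine not_vanishes_of_inv_mem (by simpa using hc) ?_ h
    rw [← map_inv₀]
    exact hk _
  · rintro rfl
    exact ⟨0, zero_mem _, map_zero _⟩

theorem HasValue.mem (hf : HasValue k P f c) : f ∈ P.toSubring := by
  simpa using add_mem (Vanishes.mem hf) (hk c)

theorem HasValue.unique (hc : HasValue k P f c) (hd : HasValue k P f d) : c = d := by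
  have h := Vanishes.sub (hasValue_iff_vanishes.1 hd) (hasValue_iff_vanishes.1 hc)
  rwa [sub_sub_sub_cancel_left, ← map_sub, vanishes_algebraMap_iff hk, sub_eq_zero] at h

theorem HasValue.mul (hf : HasValue k P f c) (hg : HasValue k P g d) :
    HasValue k P (f * g) (c * d) := by
  have h := (Vanishes.mul_right hf (hg.mem hk)).add (Vanishes.mul_left (hk c) hg)
  rw [hasValue_iff_vanishes]
  convert h using 1
  rw [map_mul]
  ring

theorem HasValue.not_vanishes (hf : HasValue k P f c) (hc : c ≠ 0) : ¬ Vanishes P f :=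
  fun h => hc (hf.unique hk (hasValue_zero_iff.2 h))

theorem HasValue.inv (hf : HasValue k P f c) (hc : c ≠ 0) : HasValue k P f⁻¹ c⁻¹ := by
  have hf0 : f ≠ 0 := ne_zero_of_not_vanishes (hf.not_vanishes hk hc)
  have hc0 : algebraMap k K c ≠ 0 := by simpa using hc
  have hinv := inv_mem_of_not_vanishes (hf.mem hk) (hf.not_vanishes hk hc)
  have h := Vanishes.mul_right (Vanishes.mul_left (neg_mem (hk c⁻¹)) hf) hinv
  rw [hasValue_iff_vanishes]
  convert h using 1
  rw [map_inv₀]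
  field_simp
  ring

end Values

section AffinePoints

variable {k : Type*} [Field k] {r : ℕ} {α : Fin r → k}

theorem affinePoint_eq_chartPoint (α : Fin r → k) : affinePoint k α =
    chartPoint k (fun _ => false) ⟨RingHom.ker (MvPolynomial.eval α), RingHom.ker_isPrime _⟩ := rfl

theorem algebraMap_mem_affinePoint (α : Fin r → k) (c : k) :
    algebraMap k _ c ∈ (affinePoint k α).toSubring :=
  algebraMap_mem_chartPoint _ _ c

theorem affineMap_C (c : k) :
    affineMap (MvPolynomial.C c) = algebraMap k (FunField k r) c := by
  rw [← chartMap_affine]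
  exact (chartMap k _).commutes c

theorem hasValue_affineMap (α : Fin r → k) (p : MvPolynomial (Fin r) k) :
    HasValue k (affinePoint k α) (affineMap p) (MvPolynomial.eval α p) := by
  rw [hasValue_iff_vanishes, ← affineMap_C, ← map_sub, affinePoint_eq_chartPoint,
    vanishes_chartPoint_affineMap, RingHom.mem_ker, map_sub, MvPolynomial.eval_C, sub_self]

theorem exists_hasValue {f : FunField k r} (hf : f ∈ (affinePoint k α).toSubring) :
    ∃ c, HasValue k (affinePoint k α) f c := by
  obtain ⟨a, b, hb, rfl⟩ := mem_chartPoint.1 hf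
  rw [chartMap_affine, chartMap_affine, div_eq_mul_inv]
  have hk := algebraMap_mem_affinePoint α
  exact ⟨_, (hasValue_affineMap α a).mul hk ((hasValue_affineMap α b).inv hk hb)⟩

theorem exists_hasValue_inv_of_ord_eq_zero {f : FunField k r} (hf : f ≠ 0)
    (h : ∀ Y : PrimeDivisor (P1Pow k r), Y.IsAffine → Y.Through (affinePoint k α) → Y.ord f = 0) :
    ∃ c, c ≠ 0 ∧ HasValue k (affinePoint k α) f⁻¹ c := by
  have hmem : f ∈ (affinePoint k α).toSubring :=
    mem_chartPoint_of_ord_nonneg fun Y hY hα => (h Y hY hα).ge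
  have hinv : f⁻¹ ∈ (affinePoint k α).toSubring :=
    mem_chartPoint_of_ord_nonneg fun Y hY hα => by rw [Y.ord_inv, h Y hY hα, neg_zero]
  obtain ⟨c, hc⟩ := exists_hasValue hinv
  refine ⟨c, ?_, hc⟩
  rintro rfl
  exact not_vanishes_of_inv_mem (inv_ne_zero hf) (by rwa [inv_inv]) (hasValue_zero_iff.1 hc)

end AffinePoints

section FunctionalCodes

theorem eq_zero_of_not_inSupport {K : Type*} [Field K] {X : Set (LocalSubring K)} {G : Divisor X}
    {P : LocalSubring K} (h : ¬ InSupport G P) {Y : PrimeDivisor X} (hY : Y.Through P) :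
    G Y = 0 := by
  by_contra hG
  exact h ⟨Y, hG, hY⟩

variable {k : Type*} [Field k] {r : ℕ}

theorem polarSum_apply_polarDivisor (m : Fin r → ℕ) (i : Fin r) :
    (∑ i, Finsupp.single (polarDivisor k i) (m i : ℤ)) (polarDivisor k i) = m i := by
  classical
  rw [Finsupp.finsetSum_apply, Finset.sum_eq_single i]
  · exact Finsupp.single_eq_same
  · exact fun j _ hj => Finsupp.single_eq_of_ne (polarDivisor_injective.ne hj.symm)
  · exact fun h => absurd (Finset.mem_univ i) h

theorem polarSum_apply_of_isAffine (m : Fin r → ℕ) {Y : PrimeDivisor (P1Pow k r)}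
    (hY : Y.IsAffine) : (∑ i, Finsupp.single (polarDivisor k i) (m i : ℤ)) Y = 0 := by
  rw [Finsupp.finsetSum_apply]
  refine Finset.sum_eq_zero fun i _ => Finsupp.single_eq_of_ne ?_
  rintro rfl
  exact coord_notMem_polarDivisor i (hY i)

theorem functionalCode_eq_evaluationCode {G : Divisor (P1Pow k r)} {H : FunField k r} (hH : H ≠ 0)
    (hG : ∀ Y : PrimeDivisor (P1Pow k r), Y.IsAffine → Y.ord H = G Y) {w : (Fin r → k) → k}
    (hw : ∀ α, HasValue k (affinePoint k α) H⁻¹ (w α)) :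
    functionalCode k (affinePoint k) G =
      evaluationCode w fun i => G (polarDivisor k i) - (polarDivisor k i).ord H := by
  have hvalue (p : MvPolynomial (Fin r) k) (α) : HasValue k (affinePoint k α) (affineMap p / H)
      (w α * MvPolynomial.eval α p) := by
    rw [div_eq_inv_mul]
    exact (hw α).mul (algebraMap_mem_affinePoint α) (hasValue_affineMap α p)
  ext v
  constructor
  · rintro ⟨f, hf, hv⟩
    obtain ⟨p, hp, rfl⟩ := (mem_rrSpace_iff hH hG).1 hf
    exact ⟨p, hp, fun α => (hv α).unique (algebraMap_mem_affinePoint α) (hvalue p α)⟩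
  · rintro ⟨p, hp, hv⟩
    exact ⟨_, (mem_rrSpace_iff hH hG).2 ⟨p, hp, rfl⟩, fun α => hv α ▸ hvalue p α⟩

theorem functionalCode_polarSum (m : Fin r → ℕ) :
    functionalCode k (affinePoint k) (∑ i, Finsupp.single (polarDivisor k i) (m i : ℤ)) =
      evaluationCode 1 fun i => m i := by
  rw [functionalCode_eq_evaluationCode (H := 1) (w := 1) one_ne_zero]
  · simp_rw [polarSum_apply_polarDivisor, PrimeDivisor.ord_one, sub_zero]
  · exact fun Y hY => by rw [polarSum_apply_of_isAffine m hY, Y.ord_one]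
  · exact fun α => by simpa using hasValue_affineMap α 1

theorem exists_functionalCode_eq_evaluationCode {G : Divisor (P1Pow k r)}
    (hG : ∀ α, ¬ InSupport G (affinePoint k α)) :
    ∃ w n, (∀ α, w α ≠ 0) ∧ functionalCode k (affinePoint k) G = evaluationCode w n := by
  obtain ⟨H, hH, hHG⟩ := exists_ord_eq_divisor G
  have hvalue (α) : ∃ c, c ≠ 0 ∧ HasValue k (affinePoint k α) H⁻¹ c :=
    exists_hasValue_inv_of_ord_eq_zero hH fun Y hY hα => by
      rw [hHG Y hY, eq_zero_of_not_inSupport (hG α) hα]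
  choose w hw0 hw using hvalue
  exact ⟨w, _, hw0, functionalCode_eq_evaluationCode hH hHG hw⟩

end FunctionalCodes

section Derivations

theorem alternatingMap_eq_det_smul {R M N ι : Type*} [CommRing R] [AddCommGroup M] [Module R M]
    [AddCommGroup N] [Module R N] [Fintype ι] [DecidableEq ι] (e : Module.Basis ι R M)
    (f : M [⋀^ι]→ₗ[R] N) (v : ι → M) : f v = e.det v • f e := by
  have h : f = (LinearMap.toSpanSingleton R N (f e)).compAlternatingMap e.det := by
    refine Module.Basis.ext_alternating e fun i hi => ?_
    let σ : Equiv.Perm ι := Equiv.ofBijective i (Finite.injective_iff_bijective.1 hi)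
    change f (e ∘ σ) = LinearMap.compAlternatingMap _ e.det (e ∘ σ)
    simp [AlternatingMap.map_perm, e.det_self]
  exact congrArg (fun g : M [⋀^ι]→ₗ[R] N => g v) h

theorem derivation_aeval {R A M σ : Type*} [CommRing R] [CommRing A] [Algebra R A]
    [AddCommGroup M] [Module A M] [Module R M] [Fintype σ] (d : Derivation R A M) (x : σ → A)
    (p : MvPolynomial σ R) :
    d (MvPolynomial.aeval x p) =
      ∑ j, MvPolynomial.aeval x (MvPolynomial.pderiv j p) • d (x j) := by
  classical
  induction p using MvPolynomial.induction_on with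
  | C c => simp
  | add p q hp hq => simp [add_smul, Finset.sum_add_distrib, hp, hq]
  | mul_X p i hp =>
    simp [hp, MvPolynomial.pderiv_X, Pi.single_apply, add_smul, mul_smul, Finset.smul_sum,
      Finset.sum_add_distrib, apply_ite (MvPolynomial.aeval x), ite_smul]

/-- The restriction of a derivation of a field to a subring that it preserves. -/
def restrictDerivation {k K : Type*} [CommRing k] [Field K] [Algebra k K] (d : Derivation k K K)
    (A : Subring K) (hA : ∀ a ∈ A, d a ∈ A) : Derivation ℤ A A :=
  Derivation.mk' (AddMonoidHom.mk' (fun a : A => (⟨d a, hA a a.2⟩ : A))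
    fun a b => Subtype.ext (map_add d (a : K) b)).toIntLinearMap
    fun a b => Subtype.ext (d.leibniz (a : K) b)

theorem isUnit_det_derivation {k R ι : Type*} [CommRing k] [CommRing R] [IsLocalRing R]
    [Algebra k R] [Fintype ι] [DecidableEq ι] (d : ι → Derivation k R R) {x y : ι → R}
    (hx : ∀ i, x i ∈ IsLocalRing.maximalIdeal R) (hy : ∀ i, y i ∈ Ideal.span (Set.range x))
    (hd : ∀ i j, d j (y i) = if i = j then 1 else 0) :
    IsUnit (Matrix.of fun i j => d j (x i)).det := by
  simp_rw [Ideal.mem_span_range_iff_exists_fun] at hy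
  choose B hB using hy
  let φ := IsLocalRing.residue R
  have hφx (i) : φ (x i) = 0 := (IsLocalRing.residue_eq_zero_iff _).2 (hx i)
  have hmul : φ.mapMatrix (Matrix.of B) * φ.mapMatrix (Matrix.of fun i j => d j (x i)) = 1 := by
    ext i j
    have hij := congrArg φ (hd i j)
    simp only [← hB, map_sum, Derivation.leibniz, smul_eq_mul, map_add, map_mul, hφx, zero_mul,
      add_zero] at hij
    simp [Matrix.mul_apply, hij, Matrix.one_apply, apply_ite φ]
  rw [← isUnit_map_iff φ, RingHom.map_det]
  exact IsUnit.of_mul_eq_one_right _ (by rw [← Matrix.det_mul, hmul, Matrix.det_one])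

end Derivations

section Forms

variable (k : Type*) [Field k] {r : ℕ}

/-- The basis of the Kähler differentials of the function field formed by the differentials of the
coordinates. -/
noncomputable def coordBasis : Module.Basis (Fin r) (FunField k r) (Ω[FunField k r⁄k]) :=
  haveI : Algebra.FormallyEtale (MvPolynomial (Fin r) k) (FunField k r) :=
    Algebra.FormallyEtale.of_isLocalization (nonZeroDivisors (MvPolynomial (Fin r) k))
  ((KaehlerDifferential.mvPolynomialBasis k (Fin r)).baseChange (FunField k r)).map
    (KaehlerDifferential.tensorKaehlerEquivOfFormallyEtale k (MvPolynomial (Fin r) k)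
      (FunField k r))

theorem coordBasis_apply (i : Fin r) :
    coordBasis k i = KaehlerDifferential.D k (FunField k r) (coord k i) := by
  rw [coordBasis, Module.Basis.map_apply, Module.Basis.baseChange_apply,
    KaehlerDifferential.mvPolynomialBasis_apply,
    KaehlerDifferential.tensorKaehlerEquivOfFormallyEtale_apply,
    KaehlerDifferential.mapBaseChange_tmul, one_smul, KaehlerDifferential.map_D]
  rfl

/-- The derivative of the `i`-th coordinate of the chart `s` with respect to `coord k i`. -/
noncomputable def chartScale (s : Fin r → Bool) (i : Fin r) : FunField k r :=
  if s i then -(coord k i)⁻¹ ^ 2 else 1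

theorem chartScale_ne_zero (s : Fin r → Bool) (i : Fin r) : chartScale k s i ≠ 0 := by
  unfold chartScale
  split_ifs
  · simpa using coord_ne_zero k i
  · exact one_ne_zero

theorem D_chartCoord (s : Fin r → Bool) (i : Fin r) :
    KaehlerDifferential.D k (FunField k r) (chartCoord k s i) =
      chartScale k s i • KaehlerDifferential.D k (FunField k r) (coord k i) := by
  unfold chartCoord chartScale
  split_ifs
  · exact Derivation.leibniz_inv _ _
  · rw [one_smul]

/-- The basis of the Kähler differentials formed by the differentials of the coordinates of the
chart `s`. -/
noncomputable def chartBasis (s : Fin r → Bool) :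
    Module.Basis (Fin r) (FunField k r) (Ω[FunField k r⁄k]) :=
  (coordBasis k).isUnitSMul fun i => (chartScale_ne_zero k s i).isUnit

theorem chartBasis_apply (s : Fin r → Bool) (i : Fin r) :
    chartBasis k s i = KaehlerDifferential.D k (FunField k r) (chartCoord k s i) := by
  rw [chartBasis, Module.Basis.isUnitSMul_apply, coordBasis_apply, D_chartCoord]

/-- The partial derivative with respect to the `j`-th coordinate of the chart `s`. -/
noncomputable def chartPartial (s : Fin r → Bool) (j : Fin r) :
    Derivation k (FunField k r) (FunField k r) :=
  ((chartBasis k s).coord j).compDer (KaehlerDifferential.D k (FunField k r))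

theorem chartPartial_chartCoord (s : Fin r → Bool) (i j : Fin r) :
    chartPartial k s j (chartCoord k s i) = if i = j then 1 else 0 := by
  change (chartBasis k s).coord j (KaehlerDifferential.D k (FunField k r) (chartCoord k s i)) = _
  rw [← chartBasis_apply, Module.Basis.coord_apply, Module.Basis.repr_self, Finsupp.single_apply]

theorem chartPartial_chartMap (s : Fin r → Bool) (j : Fin r) (p : MvPolynomial (Fin r) k) :
    chartPartial k s j (chartMap k s p) = chartMap k s (MvPolynomial.pderiv j p) := by
  simp [chartMap, derivation_aeval, chartPartial_chartCoord]

theorem wedgeD_eq_det_smul (s : Fin r → Bool) (b : Fin r → FunField k r) :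
    wedgeD k b =
      (Matrix.of fun i j => chartPartial k s j (b i)).det • wedgeD k (chartCoord k s) := by
  have he : ⇑(chartBasis k s) = fun i => KaehlerDifferential.D k _ (chartCoord k s i) :=
    funext (chartBasis_apply k s)
  rw [wedgeD, wedgeD, alternatingMap_eq_det_smul (chartBasis k s), he, ← Matrix.det_transpose]
  rfl

theorem wedgeD_chartCoord (s : Fin r → Bool) :
    wedgeD k (chartCoord k s) = (∏ i, chartScale k s i) • wedgeD k (coord k) := by
  rw [wedgeD, wedgeD, ← AlternatingMap.map_smul_univ]
  simp_rw [D_chartCoord]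

theorem wedgeD_coord_ne_zero : wedgeD k (coord k : Fin r → FunField k r) ≠ 0 := by
  intro h
  have hdet := congrArg (exteriorPower.alternatingMapLinearEquiv (coordBasis k).det) h
  simp_rw [wedgeD, exteriorPower.alternatingMapLinearEquiv_apply_ιMulti, ← coordBasis_apply,
    map_zero] at hdet
  exact one_ne_zero ((coordBasis k).det_self.symm.trans hdet)

theorem exists_eq_smul_wedgeD (ω : ⋀[FunField k r]^r (Ω[FunField k r⁄k])) :
    ∃ g : FunField k r, ω = g • wedgeD k (coord k) := by
  suffices h : ω ∈ Submodule.span (FunField k r) {wedgeD k (coord k)} by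
    obtain ⟨g, rfl⟩ := Submodule.mem_span_singleton.1 h
    exact ⟨g, rfl⟩
  have hω : ω ∈ (⊤ : Submodule (FunField k r) (⋀[FunField k r]^r (Ω[FunField k r⁄k]))) := trivial
  rw [← exteriorPower.ιMulti_span] at hω
  refine Submodule.span_le.2 ?_ hω
  rintro _ ⟨v, rfl⟩
  refine Submodule.mem_span_singleton.2 ⟨(coordBasis k).det v, ?_⟩
  rw [wedgeD, alternatingMap_eq_det_smul (coordBasis k) (exteriorPower.ιMulti _ r) v]
  simp_rw [← coordBasis_apply]

end Forms

section RegularForms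

variable {k : Type*} [Field k] {r : ℕ} {s : Fin r → Bool}
  {q : PrimeSpectrum (MvPolynomial (Fin r) k)}

theorem chartPartial_mem_chartPoint (j : Fin r) {b : FunField k r}
    (hb : b ∈ (chartPoint k s q).toSubring) :
    chartPartial k s j b ∈ (chartPoint k s q).toSubring := by
  obtain ⟨x, y, hy, rfl⟩ := mem_chartPoint.1 hb
  have hinv : (chartMap k s y)⁻¹ ∈ (chartPoint k s q).toSubring :=
    inv_mem_of_not_vanishes (chartMap_mem_chartPoint s q y) (by rwa [vanishes_chartPoint])
  rw [Derivation.leibniz_div]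
  simp only [chartPartial_chartMap, smul_eq_mul]
  have hmem := chartMap_mem_chartPoint s q
  exact mul_mem (pow_mem hinv 2)
    (sub_mem (mul_mem (hmem _) (hmem _)) (mul_mem (hmem _) (hmem _)))

variable (s q) in
/-- The partial derivatives with respect to the coordinates of the chart `s`, as derivations of
the local ring at a point of this chart. -/
noncomputable def localPartial (j : Fin r) :
    Derivation ℤ (chartPoint k s q).toSubring (chartPoint k s q).toSubring :=
  restrictDerivation (chartPartial k s j) _ fun _ => chartPartial_mem_chartPoint j

theorem wedgeD_coe_eq_det_smul (b : Fin r → (chartPoint k s q).toSubring) :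
    wedgeD k (fun i => (b i : FunField k r)) =
      ((Matrix.of fun i j => localPartial s q j (b i)).det : FunField k r) •
        wedgeD k (chartCoord k s) := by
  rw [wedgeD_eq_det_smul k s]
  congr 1
  exact ((chartPoint k s q).toSubring.subtype.map_det
    (Matrix.of fun i j => localPartial s q j (b i))).symm

theorem mem_regularForms_iff {k K : Type*} [Field k] [Field K] [Algebra k K] {r : ℕ}
    {A : Subring K} {x : Fin r → A}
    (h : ∀ b : Fin r → A, ∃ c : A, wedgeD k (fun i => (b i : K)) = c • wedgeD k fun i => (x i : K))
    {ω : ⋀[K]^r (Ω[K⁄k])} :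
    ω ∈ regularForms k r A ↔ ∃ c : A, c • (wedgeD k fun i => (x i : K)) = ω := by
  have hspan : regularForms k r A = Submodule.span A {wedgeD k fun i => (x i : K)} := by
    refine le_antisymm (Submodule.span_le.2 ?_) (Submodule.span_mono ?_)
    · rintro _ ⟨b, rfl⟩
      obtain ⟨c, hc⟩ := h b
      exact Submodule.mem_span_singleton.2 ⟨c, hc.symm⟩
    · exact Set.singleton_subset_iff.2 ⟨x, rfl⟩
  rw [hspan, Submodule.mem_span_singleton]
  rfl

theorem mem_regularForms_chartPoint {ω : ⋀[FunField k r]^r (Ω[FunField k r⁄k])} :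
    ω ∈ regularForms k r (chartPoint k s q).toSubring ↔
      ∃ c ∈ (chartPoint k s q).toSubring, c • wedgeD k (chartCoord k s) = ω := by
  rw [mem_regularForms_iff (x := fun i => ⟨_, chartCoord_mem_chartPoint s q i⟩)
    fun b => ⟨_, wedgeD_coe_eq_det_smul b⟩]
  exact ⟨fun ⟨c, hc⟩ => ⟨c, c.2, hc⟩, fun ⟨c, hmem, hc⟩ => ⟨⟨c, hmem⟩, hc⟩⟩

theorem smul_wedgeD_mem_regularForms_iff {g : FunField k r} :
    g • wedgeD k (coord k) ∈ regularForms k r (chartPoint k s q).toSubring ↔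
      g / ∏ i, chartScale k s i ∈ (chartPoint k s q).toSubring := by
  have hscale : ∏ i, chartScale k s i ≠ 0 :=
    Finset.prod_ne_zero_iff.2 fun i _ => chartScale_ne_zero k s i
  simp_rw [mem_regularForms_chartPoint, wedgeD_chartCoord, smul_smul]
  constructor
  · rintro ⟨c, hc, h⟩
    rwa [← smul_left_injective _ (wedgeD_coord_ne_zero k) h, mul_div_cancel_right₀ _ hscale]
  · exact fun h => ⟨_, h, by rw [div_mul_cancel₀ _ hscale]⟩

theorem exists_mem_regularForms_iff (Y : PrimeDivisor (P1Pow k r)) :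
    ∃ d : ℤ, (Y.IsAffine → d = 0) ∧ ∀ g : FunField k r, g ≠ 0 →
      (g • wedgeD k (coord k) ∈ regularForms k r Y.ring.toSubring ↔ 0 ≤ Y.ord g + d) := by
  obtain ⟨s, q, hq, hs⟩ : ∃ s q, Y.ring.toLocalSubring = chartPoint k s q ∧
      (Y.IsAffine → s = fun _ => false) := by
    by_cases hY : Y.IsAffine
    · obtain ⟨q, hq⟩ := hY.exists_eq_chartPoint
      exact ⟨_, q, hq, fun _ => rfl⟩
    · obtain ⟨s, q, hq⟩ := exists_eq_chartPoint Y.mem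
      exact ⟨s, q, hq, fun h => absurd h hY⟩
  have hscale : ∏ i, chartScale k s i ≠ 0 :=
    Finset.prod_ne_zero_iff.2 fun i _ => chartScale_ne_zero k s i
  refine ⟨-Y.ord (∏ i, chartScale k s i), fun hY => ?_, fun g hg => ?_⟩
  · simp [hs hY, chartScale]
  · have hring : Y.ring.toSubring = (chartPoint k s q).toSubring :=
      congrArg LocalSubring.toSubring hq
    rw [← sub_eq_add_neg, ← Y.ord_div hg hscale, ← Y.mem_ring_iff (div_ne_zero hg hscale), hring,
      smul_wedgeD_mem_regularForms_iff, ← hring]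
    rfl

theorem exists_smul_wedgeD_mem_formSpace_iff {W : PrimeDivisor (P1Pow k r) → ℤ}
    {H : FunField k r} (hH : H ≠ 0)
    (hW : ∀ Y : PrimeDivisor (P1Pow k r), Y.IsAffine → Y.ord H = W Y) :
    ∃ n : Fin r → ℤ, ∀ g : FunField k r,
      g • wedgeD k (coord k) ∈ formSpace (X := P1Pow k r) k r W ↔
        ∃ p ∈ polySpace k n, g = affineMap p / H := by
  choose d hd0 hd using exists_mem_regularForms_iff (k := k) (r := r)
  have hform (g : FunField k r) : g • wedgeD k (coord k) ∈ formSpace (X := P1Pow k r) k r W ↔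
      g ∈ rrSpace fun Y => W Y + d Y := by
    rcases eq_or_ne g 0 with rfl | hg
    · refine iff_of_true (fun Y => ?_) (Or.inl rfl)
      obtain ⟨t, ht, hord⟩ := Y.exists_ord_eq (W Y)
      exact ⟨t, ht, hord, by rw [zero_smul, smul_zero]; exact zero_mem _⟩
    refine Iff.trans (forall_congr' fun Y => ?_) (or_iff_right hg).symm
    have hmem {t : FunField k r} (ht : t ≠ 0) (hord : Y.ord t = W Y) :
        t • g • wedgeD k (coord k) ∈ regularForms k r Y.ring.toSubring ↔
          0 ≤ Y.ord g + (W Y + d Y) := by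
      rw [smul_smul, hd Y _ (mul_ne_zero ht hg), Y.ord_mul ht hg, hord, add_comm (W Y), add_assoc]
    constructor
    · rintro ⟨t, ht, hord, h⟩
      exact (hmem ht hord).1 h
    · intro h
      obtain ⟨t, ht, hord⟩ := Y.exists_ord_eq (W Y)
      exact ⟨t, ht, hord, (hmem ht hord).2 h⟩
  exact ⟨_, fun g => (hform g).trans (mem_rrSpace_iff hH fun Y hY => by
    rw [hd0 Y hY, add_zero, hW Y hY])⟩

theorem localPartial_chartCoord_sub (c : k) (i j : Fin r) :
    localPartial s q j (⟨_, chartCoord_mem_chartPoint s q i⟩ -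
      ⟨_, algebraMap_mem_chartPoint s q c⟩) = if i = j then 1 else 0 := by
  refine Subtype.ext ?_
  change chartPartial k s j (chartCoord k s i - algebraMap k _ c) = _
  rw [map_sub, Derivation.map_algebraMap, sub_zero, chartPartial_chartCoord]
  split_ifs <;> rfl

theorem exists_isUnit_wedgeD_eq_smul {α : Fin r → k}
    (hq : q.asIdeal = RingHom.ker (MvPolynomial.eval α))
    {x : Fin r → (chartPoint k s q).toSubring}
    (hx : Ideal.span (Set.range x) = IsLocalRing.maximalIdeal (chartPoint k s q).toSubring) :
    ∃ u : (chartPoint k s q).toSubring, IsUnit u ∧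
      wedgeD k (fun i => (x i : FunField k r)) =
        (u : FunField k r) • wedgeD k (chartCoord k s) := by
  refine ⟨_, isUnit_det_derivation (localPartial s q) (fun i => hx ▸ Ideal.subset_span ⟨i, rfl⟩)
    (fun i => ?_) (fun i j => localPartial_chartCoord_sub (α i) i j), wedgeD_coe_eq_det_smul x⟩
  rw [hx, ← vanishes_coe]
  have h : Vanishes (chartPoint k s q)
      (chartMap k s (MvPolynomial.X i - MvPolynomial.C (α i))) := by
    rw [vanishes_chartPoint, hq, RingHom.mem_ker]
    simp
  rwa [map_sub, chartMap_X, ← MvPolynomial.algebraMap_eq, AlgHom.commutes] at h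

end RegularForms

section FormalIndependence

theorem injective_of_surjective_ringEnd {A : Type*} [CommRing A] [IsNoetherianRing A]
    {f : A →+* A} (hf : Function.Surjective f) : Function.Injective f := by
  have hsucc (n : ℕ) (y : A) : (f ^ (n + 1)) y = f ((f ^ n) y) := by rw [pow_succ']; rfl
  have hmono : Monotone fun n => RingHom.ker (f ^ n) :=
    monotone_nat_of_le_succ fun n y hy => by
      rw [RingHom.mem_ker] at hy ⊢
      rw [hsucc, hy, map_zero]
  obtain ⟨n, hn⟩ := monotone_stabilizes_iff_noetherian.2 inferInstance ⟨_, hmono⟩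
  rw [injective_iff_map_eq_zero]
  intro z hz
  have hsurj : Function.Surjective (f ^ n) := by
    rw [RingHom.coe_pow]
    exact hf.iterate n
  obtain ⟨y, rfl⟩ := hsurj z
  have hy : y ∈ RingHom.ker (f ^ (n + 1)) := (hsucc n y).trans hz
  exact (hn (n + 1) n.le_succ).ge hy

variable {k R σ : Type*} [CommRing k] [CommRing R] [Algebra k R]

variable (k) in
/-- The family `x` is formally independent over `k`: a polynomial whose value at `x` lies in the
`n`-th power of the ideal generated by `x` has no terms of degree less than `n`. This is what makes
power series expansions in `x` unique. -/
def FormallyIndependent (x : σ → R) : Prop :=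
  ∀ (n : ℕ) (p : MvPolynomial σ k), MvPolynomial.aeval x p ∈ Ideal.span (Set.range x) ^ n →
    p ∈ MvPolynomial.idealOfVars σ k ^ n

variable {x y : σ → R}

theorem map_aeval_idealOfVars (x : σ → R) :
    (MvPolynomial.idealOfVars σ k).map (MvPolynomial.aeval x) = Ideal.span (Set.range x) := by
  rw [MvPolynomial.idealOfVars, Ideal.map_span, ← Set.range_comp]
  congr 2
  ext i
  simp

theorem aeval_mem_span_pow (x : σ → R) {n : ℕ} {p : MvPolynomial σ k}
    (hp : p ∈ MvPolynomial.idealOfVars σ k ^ n) :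
    MvPolynomial.aeval x p ∈ Ideal.span (Set.range x) ^ n := by
  rw [← map_aeval_idealOfVars (k := k), ← Ideal.map_pow]
  exact Ideal.mem_map_of_mem _ hp

theorem exists_sub_aeval_mem_span_pow [Finite σ]
    (hx : ∀ z : R, ∃ c : k, z - algebraMap k R c ∈ Ideal.span (Set.range x)) (n : ℕ) (z : R) :
    ∃ p : MvPolynomial σ k, z - MvPolynomial.aeval x p ∈ Ideal.span (Set.range x) ^ n := by
  cases nonempty_fintype σ
  induction n generalizing z with
  | zero => exact ⟨0, by simp⟩
  | succ n ih =>
    obtain ⟨c, hc⟩ := hx z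
    obtain ⟨t, ht⟩ := Ideal.mem_span_range_iff_exists_fun.1 hc
    choose p hp using fun i => ih (t i)
    refine ⟨MvPolynomial.C c + ∑ i, p i * MvPolynomial.X i, ?_⟩
    have hsum : z - MvPolynomial.aeval x (MvPolynomial.C c + ∑ i, p i * MvPolynomial.X i) =
        ∑ i, (t i - MvPolynomial.aeval x (p i)) * x i := by
      simp only [map_add, map_sum, map_mul, MvPolynomial.aeval_C, MvPolynomial.aeval_X, sub_mul,
        Finset.sum_sub_distrib, ht]
      ring
    rw [hsum, pow_succ]
    exact sum_mem fun i _ => Ideal.mul_mem_mul (hp i) (Ideal.subset_span ⟨i, rfl⟩)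

theorem FormallyIndependent.of_span_eq [IsNoetherianRing k] [Finite σ]
    (hy : FormallyIndependent k y)
    (hx : ∀ z : R, ∃ c : k, z - algebraMap k R c ∈ Ideal.span (Set.range x))
    (h : Ideal.span (Set.range x) = Ideal.span (Set.range y)) : FormallyIndependent k x := by
  intro n p hp
  let J := MvPolynomial.idealOfVars σ k ^ n
  let ψ (w : σ → R) : MvPolynomial σ k ⧸ J →+* R ⧸ Ideal.span (Set.range w) ^ n :=
    Ideal.quotientMap _ (MvPolynomial.aeval (R := k) w : _ →+* R) fun _ => aeval_mem_span_pow w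
  have hsurj (w : σ → R) (hw : ∀ z : R, ∃ c : k, z - algebraMap k R c ∈ Ideal.span (Set.range w)) :
      Function.Surjective (ψ w) := by
    intro z
    obtain ⟨z, rfl⟩ := Ideal.Quotient.mk_surjective z
    obtain ⟨q, hq⟩ := exists_sub_aeval_mem_span_pow hw n z
    exact ⟨Ideal.Quotient.mk _ q, (Ideal.Quotient.eq.2 hq).symm⟩
  have hbij : Function.Bijective (ψ y) := by
    refine ⟨(injective_iff_map_eq_zero _).2 fun q hq => ?_, hsurj y (h ▸ hx)⟩
    obtain ⟨q, rfl⟩ := Ideal.Quotient.mk_surjective q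
    exact Ideal.Quotient.eq_zero_iff_mem.2 (hy n q (Ideal.Quotient.eq_zero_iff_mem.1 hq))
  let e := (Ideal.quotEquivOfEq (congrArg (· ^ n) h)).trans (RingEquiv.ofBijective _ hbij).symm
  have hinj : Function.Injective ((e : _ →+* _).comp (ψ x)) :=
    injective_of_surjective_ringEnd (e.surjective.comp (hsurj x hx))
  refine Ideal.Quotient.eq_zero_iff_mem.1 (hinj ?_)
  rw [map_zero, RingHom.comp_apply, show ψ x (Ideal.Quotient.mk _ p) = 0 from
    Ideal.Quotient.eq_zero_iff_mem.2 hp, map_zero]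

theorem FormallyIndependent.exists_powerSeries [Finite σ] (hx : FormallyIndependent k x)
    (hres : ∀ z : R, ∃ c : k, z - algebraMap k R c ∈ Ideal.span (Set.range x)) (z : R) :
    ∃ S : MvPowerSeries σ k, ∀ n,
      z - MvPolynomial.aeval x (S.truncTotal n) ∈ Ideal.span (Set.range x) ^ n := by
  choose p hp using fun n => exists_sub_aeval_mem_span_pow hres n z
  have hcompat {l n : ℕ} (h : l ≤ n) : p l - p n ∈ MvPolynomial.idealOfVars σ k ^ l := by
    refine hx l _ ?_
    rw [map_sub, ← sub_sub_sub_cancel_left _ _ z]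
    exact sub_mem (Ideal.pow_le_pow_right h (hp n)) (hp l)
  let S : MvPowerSeries σ k := fun I => (p (I.degree + 1)).coeff I
  refine ⟨S, fun n => ?_⟩
  have hS : p n - S.truncTotal n ∈ MvPolynomial.idealOfVars σ k ^ n := by
    rw [MvPolynomial.mem_pow_idealOfVars_iff']
    intro I hI
    have hI' := (MvPolynomial.mem_pow_idealOfVars_iff' _ _).1 (hcompat hI) I (Nat.lt_succ_self _)
    rw [MvPolynomial.coeff_sub, sub_eq_zero] at hI' ⊢
    rw [MvPowerSeries.coeff_truncTotal _ hI, ← hI']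
    rfl
  rw [← sub_add_sub_cancel z (MvPolynomial.aeval x (p n)), ← map_sub]
  exact add_mem (hp n) (aeval_mem_span_pow x hS)

theorem FormallyIndependent.coeff_eq_of_sub_aeval_mem [Finite σ] (hx : FormallyIndependent k x)
    {z : R} {S : MvPowerSeries σ k}
    (hS : ∀ n, z - MvPolynomial.aeval x (S.truncTotal n) ∈ Ideal.span (Set.range x) ^ n)
    {n : ℕ} {p : MvPolynomial σ k} (hp : z - MvPolynomial.aeval x p ∈ Ideal.span (Set.range x) ^ n)
    {I : σ →₀ ℕ} (hI : I.degree < n) : MvPowerSeries.coeff I S = p.coeff I := by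
  have h := hx n (S.truncTotal n - p) (by
    rw [map_sub, ← sub_sub_sub_cancel_left _ _ z]
    exact sub_mem hp (hS n))
  rw [← sub_eq_zero, ← MvPowerSeries.coeff_truncTotal _ hI, ← MvPolynomial.coeff_sub]
  exact (MvPolynomial.mem_pow_idealOfVars_iff' _ _).1 h I hI

theorem FormallyIndependent.coeff_eq_of_sub_mem_span_pow [Fintype σ] (hx : FormallyIndependent k x)
    (hres : ∀ z : R, ∃ c : k, z - algebraMap k R c ∈ Ideal.span (Set.range x)) {a : ℕ}
    (ha : 0 < a) {z : R} {c : k}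
    (hz : z - algebraMap k R c * ∏ j, x j ^ (a - 1) ∈ Ideal.span (Set.range fun i => x i ^ a))
    {S : MvPowerSeries σ k}
    (hS : ∀ n, z - MvPolynomial.aeval x (S.truncTotal n) ∈ Ideal.span (Set.range x) ^ n) :
    MvPowerSeries.coeff (Finsupp.equivFunOnFinite.symm fun _ => a - 1) S = c := by
  classical
  set e : σ →₀ ℕ := Finsupp.equivFunOnFinite.symm fun _ => a - 1
  obtain ⟨t, ht⟩ := Ideal.mem_span_range_iff_exists_fun.1 hz
  choose q hq using fun i => exists_sub_aeval_mem_span_pow hres (e.degree + 1) (t i)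
  have hmonomial : MvPolynomial.monomial e c =
      MvPolynomial.C c * ∏ j, MvPolynomial.X j ^ (a - 1) := by
    rw [MvPolynomial.monomial_eq, Finsupp.prod_fintype _ _ (by simp)]
    rfl
  have hsum : z - MvPolynomial.aeval x
        (MvPolynomial.monomial e c + ∑ i, q i * MvPolynomial.X i ^ a) =
      ∑ i, (t i - MvPolynomial.aeval x (q i)) * x i ^ a := by
    simp only [hmonomial, map_add, map_mul, map_sum, map_prod, map_pow, MvPolynomial.aeval_X,
      MvPolynomial.aeval_C, sub_mul, Finset.sum_sub_distrib, ht]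
    ring
  have hq0 (i : σ) : (q i * MvPolynomial.X i ^ a).coeff e = 0 := by
    rw [MvPolynomial.X_pow_eq_monomial, MvPolynomial.coeff_mul_monomial', if_neg]
    have hei : e i < a := Nat.sub_lt ha one_pos
    simpa using hei
  rw [hx.coeff_eq_of_sub_aeval_mem hS
      (hsum ▸ sum_mem fun i _ => Ideal.mul_mem_right _ _ (hq i)) (Nat.lt_succ_self _),
    MvPolynomial.coeff_add, MvPolynomial.coeff_monomial, if_pos rfl, MvPolynomial.coeff_sum,
    Finset.sum_eq_zero fun i _ => hq0 i, add_zero]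

theorem mul_sub_mem_span_range_pow [Fintype σ] {a : ℕ} (ha : 0 < a) {w c v d : R}
    (hw : w - c * ∏ j, x j ^ (a - 1) ∈ Ideal.span (Set.range fun i => x i ^ a))
    (hv : v - d ∈ Ideal.span (Set.range x)) :
    v * w - d * c * ∏ j, x j ^ (a - 1) ∈ Ideal.span (Set.range fun i => x i ^ a) := by
  classical
  have hprod (i : σ) : x i * ∏ j, x j ^ (a - 1) ∈ Ideal.span (Set.range fun i => x i ^ a) := by
    rw [← Finset.mul_prod_erase _ _ (Finset.mem_univ i), ← mul_assoc,
      mul_pow_sub_one ha.ne']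
    exact Ideal.mul_mem_right _ _ (Ideal.subset_span ⟨i, rfl⟩)
  have hle : Ideal.span (Set.range x) ≤
      (Ideal.span (Set.range fun i => x i ^ a)).colon {∏ j, x j ^ (a - 1)} := by
    rw [Ideal.span_le]
    rintro _ ⟨i, rfl⟩
    exact Submodule.mem_colon_singleton.2 (hprod i)
  have hsplit : v * w - d * c * ∏ j, x j ^ (a - 1) =
      v * (w - c * ∏ j, x j ^ (a - 1)) + c * ((v - d) * ∏ j, x j ^ (a - 1)) := by ring
  rw [hsplit]
  exact add_mem (Ideal.mul_mem_left _ _ hw)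
    (Ideal.mul_mem_left _ _ (Submodule.mem_colon_singleton.1 (hle hv)))

end FormalIndependence

section LocalParameters

section

variable {k σ A R : Type*} [CommRing k] [CommRing A] [CommRing R] [Algebra k R] [Algebra A R]
  [IsLocalRing R] (e : MvPolynomial σ k ≃+* A) (p : Ideal A) [p.IsMaximal]
  [IsLocalization.AtPrime R p] (hp : (MvPolynomial.idealOfVars σ k).map e = p) {x : σ → R}
  (hx : ∀ q, MvPolynomial.aeval x q = algebraMap A R (e q))
include hp hx

theorem span_range_eq_maximalIdeal_of_isLocalization :
    Ideal.span (Set.range x) = IsLocalRing.maximalIdeal R := by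
  rw [← map_aeval_idealOfVars (k := k), ← IsLocalization.AtPrime.map_eq_maximalIdeal p R, ← hp]
  have hcomp : ((MvPolynomial.aeval x : MvPolynomial σ k →ₐ[k] R) : MvPolynomial σ k →+* R) =
      (algebraMap A R).comp (e : MvPolynomial σ k →+* A) := RingHom.ext hx
  calc (MvPolynomial.idealOfVars σ k).map (MvPolynomial.aeval x)
      = (MvPolynomial.idealOfVars σ k).map ((algebraMap A R).comp (e : MvPolynomial σ k →+* A)) :=
        hcomp ▸ rfl
    _ = ((MvPolynomial.idealOfVars σ k).map e).map (algebraMap A R) := (Ideal.map_map _ _).symm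

theorem FormallyIndependent.of_isLocalization : FormallyIndependent k x := by
  intro n q hq
  rw [span_range_eq_maximalIdeal_of_isLocalization e p hp hx, hx, ← Ideal.mem_comap] at hq
  have hq' : e q ∈ (MvPolynomial.idealOfVars σ k ^ n).map e := by
    rw [Ideal.map_pow, hp, ← IsLocalization.AtPrime.under_maximalIdeal_pow p R n]
    exact hq
  rwa [← Ideal.comap_symm, Ideal.mem_comap, RingEquiv.symm_apply_apply] at hq'

end

variable {k : Type*} [Field k] {r : ℕ} {α : Fin r → k}

noncomputable instance (α : Fin r → k) : Algebra k (affinePoint k α).toSubring :=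
  ((algebraMap k (FunField k r)).codRestrict _ (algebraMap_mem_affinePoint α)).toAlgebra

theorem coe_algebraMap_affinePoint (c : k) :
    (algebraMap k (affinePoint k α).toSubring c : FunField k r) = algebraMap k _ c := rfl

theorem coe_aeval_affinePoint (x : Fin r → (affinePoint k α).toSubring)
    (p : MvPolynomial (Fin r) k) : (MvPolynomial.aeval x p : FunField k r) =
      MvPolynomial.aeval (fun i => (x i : FunField k r)) p :=
  (MvPolynomial.map_aeval x (affinePoint k α).toSubring.subtype p).trans rfl

/-- The translation `X_i ↦ X_i - α_i`. -/
noncomputable def translate (α : Fin r → k) : MvPolynomial (Fin r) k →ₐ[k] MvPolynomial (Fin r) k :=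
  MvPolynomial.aeval fun i => MvPolynomial.X i - MvPolynomial.C (α i)

theorem translate_translate_neg (α : Fin r → k) :
    (translate α).comp (translate (-α)) = AlgHom.id k _ := by
  ext i
  simp [translate]

/-- Translation by `-α` in the coordinates, with inverse the translation by `α`. -/
noncomputable def translateEquiv (α : Fin r → k) :
    MvPolynomial (Fin r) k ≃ₐ[k] MvPolynomial (Fin r) k :=
  .ofAlgHom (translate α) (translate (-α)) (translate_translate_neg α)
    (by simpa using translate_translate_neg (-α))

theorem map_translateEquiv_idealOfVars (α : Fin r → k) :
    (MvPolynomial.idealOfVars (Fin r) k).map (translateEquiv α) =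
      RingHom.ker (MvPolynomial.eval α) := by
  have hcomp : MvPolynomial.constantCoeff.comp
      ((translateEquiv α).symm : MvPolynomial (Fin r) k →+* MvPolynomial (Fin r) k) =
        MvPolynomial.eval α := by
    ext i
    · simp [translateEquiv, translate]
    · simp [translateEquiv, translate]
  ext p
  rw [← pow_one (MvPolynomial.idealOfVars (Fin r) k)]
  change p ∈ Ideal.map (translateEquiv α).toRingEquiv _ ↔ _
  rw [← Ideal.comap_symm, Ideal.mem_comap, MvPolynomial.mem_pow_idealOfVars_iff', RingHom.mem_ker,
    ← hcomp]
  simp only [Nat.lt_one_iff, Finsupp.degree_eq_zero_iff, forall_eq]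
  rfl

/-- The local parameters `x_i - α_i` at the affine point `α`. -/
noncomputable def shiftedCoord (α : Fin r → k) (i : Fin r) : (affinePoint k α).toSubring :=
  ⟨affineMap (MvPolynomial.X i - MvPolynomial.C (α i)), affineMap_mem_chartPoint _ _⟩

theorem coe_aeval_shiftedCoord (p : MvPolynomial (Fin r) k) :
    (MvPolynomial.aeval (shiftedCoord α) p : FunField k r) = affineMap (translateEquiv α p) := by
  rw [coe_aeval_affinePoint]
  have : MvPolynomial.aeval (fun i => (shiftedCoord α i : FunField k r)) =
      (IsScalarTower.toAlgHom k (MvPolynomial (Fin r) k) (FunField k r)).comp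
        (translateEquiv α : _ →ₐ[k] _) := by
    ext i
    simp [shiftedCoord, translateEquiv, translate]
  rw [this]
  rfl

variable (α) in
/-- The maximal ideal of the point `α` in the coordinate ring of the affine chart. -/
noncomputable abbrev affineIdeal : Ideal (chart k fun _ : Fin r => false).toSubring :=
  (chartPrime k (fun _ => false)
    ⟨RingHom.ker (MvPolynomial.eval α), RingHom.ker_isPrime _⟩).asIdeal

instance : (affineIdeal α).IsMaximal := by
  have := RingHom.ker_isMaximal_of_surjective (MvPolynomial.eval α)
    fun c => ⟨MvPolynomial.C c, MvPolynomial.eval_C c⟩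
  exact Ideal.comap_isMaximal_of_equiv (chartEquiv k fun _ => false).symm.toRingEquiv

noncomputable instance :
    Algebra (chart k fun _ : Fin r => false).toSubring (affinePoint k α).toSubring :=
  inferInstanceAs (Algebra _ (LocalSubring.ofPrime _ (affineIdeal α)).toSubring)

instance : IsLocalization.AtPrime (affinePoint k α).toSubring (affineIdeal α) :=
  inferInstanceAs (IsLocalization.AtPrime (LocalSubring.ofPrime _ (affineIdeal α)).toSubring _)

variable (α) in
/-- The identification of the affine chart with affine space that moves `α` to the origin. -/
noncomputable def centeredChartEquiv :
    MvPolynomial (Fin r) k ≃+* (chart k fun _ : Fin r => false).toSubring :=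
  ((translateEquiv α).trans (chartEquiv k fun _ => false)).toRingEquiv

theorem map_centeredChartEquiv_idealOfVars (α : Fin r → k) :
    (MvPolynomial.idealOfVars (Fin r) k).map (centeredChartEquiv α) = affineIdeal α := by
  let e := (chartEquiv k fun _ : Fin r => false).toRingEquiv
  calc (MvPolynomial.idealOfVars (Fin r) k).map (centeredChartEquiv α)
      = ((MvPolynomial.idealOfVars (Fin r) k).map (translateEquiv α)).map e :=
        (Ideal.map_map (translateEquiv α).toRingEquiv.toRingHom e.toRingHom).symm
    _ = (RingHom.ker (MvPolynomial.eval α)).comap e.symm := by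
        rw [map_translateEquiv_idealOfVars, Ideal.comap_symm]

theorem aeval_shiftedCoord (p : MvPolynomial (Fin r) k) :
    MvPolynomial.aeval (shiftedCoord α) p = algebraMap _ _ (centeredChartEquiv α p) := by
  refine Subtype.ext ?_
  rw [coe_aeval_shiftedCoord, ← chartMap_affine, ← coe_chartEquiv]
  rfl

variable (α) in
theorem span_shiftedCoord : Ideal.span (Set.range (shiftedCoord α)) =
    IsLocalRing.maximalIdeal (affinePoint k α).toSubring :=
  span_range_eq_maximalIdeal_of_isLocalization _ _ (map_centeredChartEquiv_idealOfVars α)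
    aeval_shiftedCoord

variable (α) in
theorem formallyIndependent_shiftedCoord : FormallyIndependent k (shiftedCoord α) :=
  .of_isLocalization _ _ (map_centeredChartEquiv_idealOfVars α) aeval_shiftedCoord

theorem hasValue_coe_iff {z : (affinePoint k α).toSubring} {c : k} :
    HasValue k (affinePoint k α) z c ↔
      z - algebraMap k _ c ∈ IsLocalRing.maximalIdeal (affinePoint k α).toSubring :=
  vanishes_coe (z := z - algebraMap k (affinePoint k α).toSubring c)

theorem exists_sub_algebraMap_mem_maximalIdeal (z : (affinePoint k α).toSubring) :
    ∃ c : k, z - algebraMap k _ c ∈ IsLocalRing.maximalIdeal (affinePoint k α).toSubring := by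
  obtain ⟨c, hc⟩ := exists_hasValue z.2
  exact ⟨c, hasValue_coe_iff.1 hc⟩

variable {x : Fin r → (affinePoint k α).toSubring}

theorem formallyIndependent_of_span_eq_maximalIdeal
    (hx : Ideal.span (Set.range x) = IsLocalRing.maximalIdeal (affinePoint k α).toSubring) :
    FormallyIndependent k x :=
  (formallyIndependent_shiftedCoord α).of_span_eq
    (hx ▸ exists_sub_algebraMap_mem_maximalIdeal) (hx.trans (span_shiftedCoord α).symm)

theorem hasExpansion_iff
    (hx : Ideal.span (Set.range x) = IsLocalRing.maximalIdeal (affinePoint k α).toSubring)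
    {h : (affinePoint k α).toSubring} {S : MvPowerSeries (Fin r) k} : HasExpansion k x h S ↔
      ∀ n, h - MvPolynomial.aeval x (S.truncTotal n) ∈ Ideal.span (Set.range x) ^ n := by
  have hcoe (n : ℕ) (p : MvPolynomial (Fin r) k) :
      (∃ z ∈ IsLocalRing.maximalIdeal (affinePoint k α).toSubring ^ n,
        (h : FunField k r) - MvPolynomial.aeval (fun i => (x i : FunField k r)) p = z) ↔
      h - MvPolynomial.aeval x p ∈ Ideal.span (Set.range x) ^ n := by
    rw [← coe_aeval_affinePoint, hx]
    constructor
    · rintro ⟨z, hz, e⟩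
      rwa [← show h - MvPolynomial.aeval x p = z from Subtype.ext e] at hz
    · exact fun hz => ⟨_, hz, rfl⟩
  simp only [HasExpansion, hcoe]
  constructor
  · exact fun hS n => hS n _ fun I hI => MvPowerSeries.coeff_truncTotal S hI
  · intro hS n p hp
    have hmem : S.truncTotal n - p ∈ MvPolynomial.idealOfVars (Fin r) k ^ n := by
      rw [MvPolynomial.mem_pow_idealOfVars_iff']
      intro I hI
      rw [MvPolynomial.coeff_sub, MvPowerSeries.coeff_truncTotal S hI, hp I hI, sub_self]
    rw [← sub_add_sub_cancel h (MvPolynomial.aeval x (S.truncTotal n)), ← map_sub]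
    exact add_mem (hS n) (aeval_mem_span_pow x hmem)

end LocalParameters

section Residues

theorem PrimeDivisor.Through.ord_eq_zero_of_isUnit {K : Type*} [Field K] {X : Set (LocalSubring K)}
    {Y : PrimeDivisor X} {P : LocalSubring K} (hY : Y.Through P) {u : P.toSubring}
    (hu : IsUnit u) : Y.ord (u : K) = 0 := by
  obtain ⟨v, huv⟩ := hu.exists_right_inv
  have hinv : (v : K) = (u : K)⁻¹ := eq_inv_of_mul_eq_one_right (congrArg Subtype.val huv)
  have hu0 : (u : K) ≠ 0 := by simpa using hu.ne_zero
  exact Y.ord_eq_zero_of_not_vanishes (hY u.2)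
    (not_vanishes_of_inv_mem hu0 (hinv ▸ hY v.2))

variable {k : Type*} [Field k] {r : ℕ} {α : Fin r → k} {D : Fin r → Divisor (P1Pow k r)}

theorem hasResidue_iff (F : LocalChoice D (affinePoint k α))
    {ω : ⋀[FunField k r]^r (Ω[FunField k r⁄k])} {h : (affinePoint k α).toSubring}
    (hω : (∏ l, (F.f l : FunField k r)) • ω =
      (h : FunField k r) • wedgeD k (fun i => (F.x i : FunField k r)))
    {c : k} (hc : F.mat.det * h - algebraMap k _ c * ∏ j, F.x j ^ (F.a - 1) ∈ F.powIdeal)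
    {v : k} : HasResidue k F ω v ↔ v = c := by
  have hx := formallyIndependent_of_span_eq_maximalIdeal F.span_x
  have hres : ∀ z : (affinePoint k α).toSubring, ∃ c : k,
      z - algebraMap k _ c ∈ Ideal.span (Set.range F.x) :=
    F.span_x ▸ exists_sub_algebraMap_mem_maximalIdeal
  have hcoeff {S : MvPowerSeries (Fin r) k} (hS : HasExpansion k F.x (F.mat.det * h) S) :=
    hx.coeff_eq_of_sub_mem_span_pow hres F.a_pos hc ((hasExpansion_iff F.span_x).1 hS)
  constructor
  · rintro ⟨h', hω', S, hS, rfl⟩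
    obtain ⟨u, hu, hwedge⟩ := exists_isUnit_wedgeD_eq_smul (s := fun _ => false) rfl F.span_x
    have hne : wedgeD k (fun i => (F.x i : FunField k r)) ≠ 0 :=
      hwedge ▸ smul_ne_zero (by simpa using hu.ne_zero) (wedgeD_coord_ne_zero k)
    obtain rfl : h' = h := Subtype.ext (smul_left_injective _ hne (hω'.symm.trans hω))
    exact hcoeff hS
  · rintro rfl
    obtain ⟨S, hS⟩ := hx.exists_powerSeries hres (F.mat.det * h)
    have hS' := (hasExpansion_iff F.span_x).2 hS
    exact ⟨h, hω, S, hS', hcoeff hS'⟩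

theorem det_mul_sub_mem_powIdeal (F : LocalChoice D (affinePoint k α))
    {θ g : (affinePoint k α).toSubring} {c d : k}
    (hθ : ∃ z ∈ F.powIdeal, (F.mat.det : FunField k r) * θ -
      algebraMap k _ c * ∏ j, (F.x j : FunField k r) ^ (F.a - 1) = z)
    (hg : HasValue k (affinePoint k α) g d) :
    F.mat.det * (g * θ) - algebraMap k _ (d * c) * ∏ j, F.x j ^ (F.a - 1) ∈ F.powIdeal := by
  obtain ⟨z, hz, e⟩ := hθ
  obtain rfl : F.mat.det * θ - algebraMap k _ c * ∏ j, F.x j ^ (F.a - 1) = z :=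
    Subtype.ext (by simpa [coe_algebraMap_affinePoint] using e)
  rw [hasValue_coe_iff, ← F.span_x] at hg
  rw [mul_left_comm, map_mul]
  exact mul_sub_mem_span_range_pow F.a_pos hz hg

variable {G : Divisor (P1Pow k r)} {H θ : FunField k r}

theorem exists_hasValue_prod_div (F : LocalChoice D (affinePoint k α))
    (hG : ¬ InSupport G (affinePoint k α)) (hθ : θ ≠ 0) (hθα : θ ∈ (affinePoint k α).toSubring)
    (hH : H ≠ 0) (hord : ∀ Y : PrimeDivisor (P1Pow k r), Y.IsAffine →
      Y.ord H = ∑ l, D l Y - G Y - max (Y.ord θ) 0)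
    {u : (affinePoint k α).toSubring} (hu : IsUnit u) :
    ∃ b, b ≠ 0 ∧
      HasValue k (affinePoint k α) ((∏ l, (F.f l : FunField k r)) / (H * θ * u)) b := by
  have hf (l : Fin r) : (F.f l : FunField k r) ≠ 0 := by simpa using F.f_ne_zero l
  have hprod : ∏ l, (F.f l : FunField k r) ≠ 0 := Finset.prod_ne_zero_iff.2 fun l _ => hf l
  have hu0 : (u : FunField k r) ≠ 0 := by simpa using hu.ne_zero
  rw [← inv_div]
  refine exists_hasValue_inv_of_ord_eq_zero
    (div_ne_zero (mul_ne_zero (mul_ne_zero hH hθ) hu0) hprod) fun Y hY hα => ?_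
  rw [Y.ord_div (mul_ne_zero (mul_ne_zero hH hθ) hu0) hprod, Y.ord_mul (mul_ne_zero hH hθ) hu0,
    Y.ord_mul hH hθ, hord Y hY, hα.ord_eq_zero_of_isUnit hu, Y.ord_prod _ _ fun l _ => hf l,
    Finset.sum_congr rfl fun l _ => F.ord_f l Y hα, eq_zero_of_not_inSupport hG hα,
    max_eq_left (Y.ord_nonneg_of_mem (hα hθα))]
  ring

theorem exists_hasResidue_smul_wedgeD_iff (F : LocalChoice D (affinePoint k α))
    (hG : ¬ InSupport G (affinePoint k α)) (hθ : θ ≠ 0) (hθα : θ ∈ (affinePoint k α).toSubring)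
    (hc : ∃ c : k, c ≠ 0 ∧ ∃ z ∈ F.powIdeal, (F.mat.det : FunField k r) * θ -
      algebraMap k _ c * ∏ j, (F.x j : FunField k r) ^ (F.a - 1) = z)
    (hH : H ≠ 0) (hord : ∀ Y : PrimeDivisor (P1Pow k r), Y.IsAffine →
      Y.ord H = ∑ l, D l Y - G Y - max (Y.ord θ) 0) :
    ∃ w, w ≠ 0 ∧ ∀ p v, HasResidue k F ((affineMap p / H) • wedgeD k (coord k)) v ↔
      v = w * MvPolynomial.eval α p := by
  obtain ⟨c, hc0, hc⟩ := hc
  obtain ⟨u, hu, hwedge⟩ := exists_isUnit_wedgeD_eq_smul (s := fun _ => false) rfl F.span_x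
  obtain ⟨b, hb0, hb⟩ := exists_hasValue_prod_div F hG hθ hθα hH hord hu
  refine ⟨b * c, mul_ne_zero hb0 hc0, fun p v => ?_⟩
  have hk := algebraMap_mem_affinePoint α
  have hg := hb.mul hk (hasValue_affineMap α p)
  rw [hasResidue_iff F (h := ⟨_, hg.mem hk⟩ * ⟨θ, hθα⟩) ?_ (det_mul_sub_mem_powIdeal F hc hg),
    mul_right_comm]
  have hu0 : (u : FunField k r) ≠ 0 := by simpa using hu.ne_zero
  rw [hwedge, smul_smul, smul_smul, Subring.coe_mul]
  congr 1
  field_simp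

theorem exists_differentialCode_eq_evaluationCode
    (hpts : ∀ α, affinePoint k α ∈ inter D) (F : ∀ P : inter D, LocalChoice D P.1)
    (hG : ∀ α, ¬ InSupport G (affinePoint k α))
    (hθ : StrictlyRectifying k (affinePoint k) F θ) :
    ∃ w n, (∀ α, w α ≠ 0) ∧
      differentialCode k (affinePoint k) hpts F θ G = evaluationCode w n := by
  obtain ⟨hθ0, hθmem, hθc, -⟩ := hθ
  obtain ⟨H₁, hH₁, hord₁⟩ := exists_ord_eq_divisor (∑ l, D l - G)
  obtain ⟨H₂, hH₂, hord₂⟩ := exists_ord_eq_max hθ0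
  have hH : H₁ / H₂ ≠ 0 := div_ne_zero hH₁ hH₂
  have hord (Y : PrimeDivisor (P1Pow k r)) (hY : Y.IsAffine) :
      Y.ord (H₁ / H₂) = ∑ l, D l Y - G Y - max (Y.ord θ) 0 := by
    rw [Y.ord_div hH₁ hH₂, hord₁ Y hY, hord₂ Y hY, Finsupp.sub_apply, Finsupp.finsetSum_apply]
  obtain ⟨n, hn⟩ := exists_smul_wedgeD_mem_formSpace_iff hH hord
  choose w hw0 hw using fun α => exists_hasResidue_smul_wedgeD_iff (F ⟨_, hpts α⟩) (hG α) hθ0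
    (hθmem ⟨_, hpts α⟩) (hθc ⟨_, hpts α⟩ ⟨α, rfl⟩) hH hord
  refine ⟨w, n, hw0, Set.ext fun v => ⟨?_, ?_⟩⟩
  · rintro ⟨ω, hω, hv⟩
    obtain ⟨g, rfl⟩ := exists_eq_smul_wedgeD k ω
    obtain ⟨p, hp, rfl⟩ := (hn g).1 hω
    exact ⟨p, hp, fun α => (hw α p _).1 (hv α)⟩
  · rintro ⟨p, hp, hv⟩
    exact ⟨_, (hn _).2 ⟨p, hp, rfl⟩, fun α => (hw α p _).2 (hv α)⟩

end Residues

end RectifiedCodes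

open RectifiedCodes in
theorem mainTheorem7_general (k : Type*) [Field k] [Fintype k] (r : ℕ) (m : Fin r → ℕ)
    {i j : Fin r} (hij : i ≠ j) (hi : m i + 1 < Fintype.card k) (hj : m j + 1 < Fintype.card k) :
    ¬ IsFunctionalCode k (P1Pow k r) (affinePoint k)
        (dualCode (functionalCode k (affinePoint k)
          (∑ i, Finsupp.single (polarDivisor k i) (m i : ℤ)))) ∧
    ¬ IsStrictlyRectifiedCode k r (P1Pow k r) (affinePoint k)
        (dualCode (functionalCode k (affinePoint k)
          (∑ i, Finsupp.single (polarDivisor k i) (m i : ℤ)))) := by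
  rw [functionalCode_polarSum]
  constructor
  · rintro ⟨G, hG, h⟩
    obtain ⟨w, n, hw, hcode⟩ := exists_functionalCode_eq_evaluationCode hG
    exact dualCode_ne_evaluationCode hij hi hj hw n (h.trans hcode)
  · rintro ⟨G, D, hpts, F, θ, hG, -, hθ, h⟩
    obtain ⟨w, n, hw, hcode⟩ := exists_differentialCode_eq_evaluationCode hpts F hG hθ
    exact dualCode_ne_evaluationCode hij hi hj hw n (h.trans hcode)

open RectifiedCodes in
theorem mainTheorem7 (k : Type*) [Field k] [Fintype k] (r : ℕ) (hr : 2 ≤ r) (m : Fin r → ℕ)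
    (hm : ∀ i, m i + 2 < Fintype.card k) :
    ¬ IsFunctionalCode k (P1Pow k r) (affinePoint k)
        (dualCode (functionalCode k (affinePoint k)
          (∑ i, Finsupp.single (polarDivisor k i) (m i : ℤ)))) ∧
    ¬ IsStrictlyRectifiedCode k r (P1Pow k r) (affinePoint k)
        (dualCode (functionalCode k (affinePoint k)
          (∑ i, Finsupp.single (polarDivisor k i) (m i : ℤ)))) :=
  mainTheorem7_general k r m (i := ⟨0, by omega⟩) (j := ⟨1, hr⟩) (by simp)
    (Nat.lt_of_succ_lt (hm _)) (Nat.lt_of_succ_lt (hm _))
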